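/- **The refuted claim.** Suppose $\mathcal M$ and $\mathcal K$ are models of $\mathsf{ZF}$ such that the universe $K$ of $\mathcal K$ is a subset of the universe $M$ of $\mathcal M$ (the membership relation of $\mathcal K$ need not be the restriction of that of $\mathcal M$). Assume that for every parametrically $\mathcal M$-definable $D\subseteq M$ we have $(\mathcal K, D\cap K)\models\mathsf{ZF}(P)$, where $\mathsf{ZF}(P)$ is $\mathsf{ZF}$ with the Separation and Replacement schemes for all formulas in the language with an additional unary predicate $P$, interpreted by $D\cap K$. Then precisely one of the following three conditions holds: 1. there is an $(\mathcal M,\mathcal K)$-definable isomorphism between $\mathcal K$ and $(V_\kappa,\in)^{\mathcal M}$ for some strongly inaccessible cardinal $\kappa$ of $\mathcal M$; 2. there is an $(\mathcal M,\mathcal K)$-definable isomorphism between $\mathcal K$ and $\mathcal M$; 3. there is an $(\mathcal M,\mathcal K)$-definable embedding of $\mathcal M$ onto a proper rank initial segment of $\mathcal K$, that is, onto a proper subset $I$ of $K$ such that every element of $K$ whose rank, in the sense of $\mathcal K$, is at most that of some element of $I$ belongs to $I$. Here "$(\mathcal M,\mathcal K)$-definable" means definable, with parameters, in the structure with universe $M$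 that has the membership relation of $\mathcal M$, the set $K$ and the membership relation of $\mathcal K$. **Theorem.** Let $\mathcal K$ be an $\omega$-standard model of $\mathsf{ZFC}$ (the natural numbers of $\mathcal K$ are isomorphic to the true natural numbers), and let $U\in K$ be, in the sense of $\mathcal K$, a nonprincipal ultrafilter on $\omega$. Let $\mathcal M$ be the internal ultrapower of $\mathcal K$ modulo $U$: its elements are the classes $[f]_U$ of those $f\in K$ that are functions with domain $\omega$ in the sense of $\mathcal K$, where $$[f]_U=[g]_U \iff \mathcal K\models \{n\in\omega: f(n)=g(n)\}\in U,\qquad [f]_U\in^{\mathcal M}[g]_U \iff \mathcal K\models \{n\in\omega: f(n)\in g(n)\}\in U .$$ For $k\in K$ let $\underline k$ be the function on $\omega$ with constant value $k$ in $\mathcal K$. Then $j(k)=[\underline k]_U$ is an elementary embedding of $\mathcal K$ into $\mathcal M$. Identifying $\mathcal K$ with its image under $j$, the following hold: * $\mathcal M$ is an elementary extension of $\mathcal K$ that is not $\omega$-standard; * $\mathcal M$ is conservative over $\mathcal K$: for every parametrically $\mathcal M$-definable $D\subseteq M$, the set $D\cap K$ is parametrically $\mathcal K$-definable; * $\mathcal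 K$ and $\mathcal M$ satisfy the hypotheses of the claim, but none of the conditions (1), (2), (3) holds for them. Consequently the claim is false. -/

import Mathlib

open FirstOrder FirstOrder.Language

universe u

namespace SetModel

/-! ### Languages -/

/-- The only symbol of the language of set theory: binary membership. -/
inductive SetRel : ℕ → Type
  | mem : SetRel 2

/-- The first-order language of set theory. -/
def LSet : FirstOrder.Language.{0, 0} := ⟨fun _ => Empty, SetRel⟩

/-- Membership together with a fresh unary predicate `P`. -/
inductive SetPredRel : ℕ → Type
  | mem : SetPredRel 2
  | P : SetPredRel 1

/-- The language of set theory with a fresh unary predicate `P`. -/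
def LSetP : FirstOrder.Language.{0, 0} := ⟨fun _ => Empty, SetPredRel⟩

/-- Symbols for a pair of structures `(M, K)` with `K` a subset of `M`. -/
inductive PairRel : ℕ → Type
  | memM : PairRel 2
  | univK : PairRel 1
  | memK : PairRel 2

/-- The language of the structure `(M, K)`: membership of `M`, the universe of `K`,
membership of `K`. -/
def LPair : FirstOrder.Language.{0, 0} := ⟨fun _ => Empty, PairRel⟩

/-- The symbol for membership in `LSet`. -/
abbrev memSym : LSet.Relations 2 := SetRel.mem

/-- The symbol for membership in `LSetP`. -/
abbrev memSymP : LSetP.Relations 2 := SetPredRel.mem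

/-! ### The theories `ZF`, `ZFC` and `ZF(P)`

The axioms are stated for an arbitrary language `L` with a distinguished binary relation symbol `e`
for membership; the schemes range over all formulas of `L`. -/

section Axioms

variable {L : FirstOrder.Language.{0, 0}} (e : L.Relations 2)

/-- The atomic formula `v_i ∈ v_j`. -/
def memF {n : ℕ} (i j : Fin n) : L.BoundedFormula Empty n :=
  e.boundedFormula₂ (Term.var (Sum.inr i)) (Term.var (Sum.inr j))

/-- The atomic formula `v_i = v_j`. -/
def eqF (L : FirstOrder.Language.{0, 0}) {n : ℕ} (i j : Fin n) : L.BoundedFormula Empty n :=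
  (Term.var (Sum.inr i) : L.Term (Empty ⊕ Fin n)).bdEqual (Term.var (Sum.inr j))

/-- `∀ x y, (∀ z, z ∈ x ↔ z ∈ y) → x = y` -/
def axExtensionality : L.Sentence :=
  ∀' ∀' ((∀' (memF e (n := 3) 2 0 ⇔ memF e 2 1)) ⟹ eqF L 0 1)

/-- `∀ x, (∃ y, y ∈ x) → ∃ y, y ∈ x ∧ ¬ ∃ z, z ∈ x ∧ z ∈ y` -/
def axFoundation : L.Sentence :=
  ∀' ((∃' memF e (n := 2) 1 0) ⟹ ∃' (memF e (n := 2) 1 0 ⊓ ∼(∃' (memF e (n := 3) 2 0 ⊓ memF e 2 1))))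

/-- `∀ x y, ∃ z, ∀ w, w ∈ z ↔ w = x ∨ w = y` -/
def axPairing : L.Sentence :=
  ∀' ∀' ∃' ∀' (memF e (n := 4) 3 2 ⇔ (eqF L 3 0 ⊔ eqF L 3 1))

/-- `∀ x, ∃ t, ∀ z, z ∈ t ↔ ∃ y, y ∈ x ∧ z ∈ y` -/
def axUnion : L.Sentence :=
  ∀' ∃' ∀' (memF e (n := 3) 2 1 ⇔ ∃' (memF e (n := 4) 3 0 ⊓ memF e 2 3))

/-- `∀ x, ∃ p, ∀ y, y ∈ p ↔ ∀ z, z ∈ y → z ∈ x` -/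
def axPowerset : L.Sentence :=
  ∀' ∃' ∀' (memF e (n := 3) 2 1 ⇔ ∀' (memF e (n := 4) 3 2 ⟹ memF e 3 0))

/-- `∃ w, (∃ y, y ∈ w ∧ ∀ z, z ∉ y) ∧ ∀ x, x ∈ w → ∃ s, s ∈ w ∧ ∀ z, z ∈ s ↔ z ∈ x ∨ z = x` -/
def axInfinity : L.Sentence :=
  ∃' ((∃' (memF e (n := 2) 1 0 ⊓ ∀' ∼(memF e (n := 3) 2 1))) ⊓
    ∀' (memF e (n := 2) 1 0 ⟹
      ∃' (memF e (n := 3) 2 0 ⊓ ∀' (memF e (n := 4) 3 2 ⇔ (memF e 3 1 ⊔ eqF L 3 1)))))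

/-- The instance of Separation for `φ(p₀, …, pₙ₋₁, a, x)`:
`∀ p a, ∃ b, ∀ x, x ∈ b ↔ x ∈ a ∧ φ(p, a, x)`. -/
def axSeparation {n : ℕ} (φ : L.BoundedFormula Empty (n + 2)) : L.Sentence :=
  BoundedFormula.alls (n := n + 1)
    (∃' ∀' (memF e (n := n + 3) ⟨n + 2, by omega⟩ ⟨n + 1, by omega⟩ ⇔
      (memF e ⟨n + 2, by omega⟩ ⟨n, by omega⟩ ⊓ φ.liftAt 1 (n + 1))))

/-- The instance of Replacement for `φ(p₀, …, pₙ₋₁, a, x, y)`: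
`∀ p a, (∀ x ∈ a, ∃! y, φ(p, a, x, y)) → ∃ b, ∀ x ∈ a, ∃ y ∈ b, φ(p, a, x, y)`. -/
def axReplacement {n : ℕ} (φ : L.BoundedFormula Empty (n + 3)) : L.Sentence :=
  BoundedFormula.alls (n := n + 1)
    ((∀' (memF e (n := n + 2) ⟨n + 1, by omega⟩ ⟨n, by omega⟩ ⟹
        ∃' ∀' (φ.liftAt 1 (n + 2) ⇔ eqF L (n := n + 4) ⟨n + 3, by omega⟩ ⟨n + 2, by omega⟩))) ⟹
      ∃' ∀' (memF e (n := n + 3) ⟨n + 2, by omega⟩ ⟨n, by omega⟩ ⟹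
        ∃' (memF e (n := n + 4) ⟨n + 3, by omega⟩ ⟨n + 1, by omega⟩ ⊓ φ.liftAt 1 (n + 1))))

/-- Every family of nonempty pairwise disjoint sets has a transversal:
`∀ x, (∀ y ∈ x, ∃ z, z ∈ y) ∧ (∀ y ∈ x, ∀ z ∈ x, (∃ w, w ∈ y ∧ w ∈ z) → y = z) →
∃ c, ∀ y ∈ x, ∃ w, ∀ v, (v ∈ y ∧ v ∈ c) ↔ v = w`. -/
def axChoice : L.Sentence :=
  ∀' (((∀' (memF e (n := 2) 1 0 ⟹ ∃' memF e (n := 3) 2 1)) ⊓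
      ∀' (memF e (n := 2) 1 0 ⟹ ∀' (memF e (n := 3) 2 0 ⟹
        ((∃' (memF e (n := 4) 3 1 ⊓ memF e 3 2)) ⟹ eqF L 1 2)))) ⟹
    ∃' ∀' (memF e (n := 3) 2 0 ⟹
      ∃' ∀' ((memF e (n := 5) 4 2 ⊓ memF e 4 1) ⇔ eqF L 4 3)))

/-- `ZF` in the language `L`, with both schemes for all formulas of `L`. -/
def ZF : L.Theory :=
  {axExtensionality e, axFoundation e, axPairing e, axUnion e, axPowerset e, axInfinity e} ∪
    {σ | ∃ (n : ℕ) (φ : L.BoundedFormula Empty (n + 2)), σ = axSeparation e φ} ∪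
    {σ | ∃ (n : ℕ) (φ : L.BoundedFormula Empty (n + 3)), σ = axReplacement e φ}

/-- `ZFC` in the language `L`. -/
def ZFC : L.Theory := ZF e ∪ {axChoice e}

end Axioms

/-! ### Set-theoretic notions inside a structure

Each predicate below spells out the satisfaction in `M` of the usual set-theoretic formula. -/

section Internal

variable {M : Type u} [LSet.Structure M]

/-- The membership relation of the structure. -/
def Mem (x y : M) : Prop := Structure.RelMap memSym ![x, y]

infix:50 " ∈ₘ " => Mem

/-- `x ⊆ y`. -/
def Sub (x y : M) : Prop := ∀ z, z ∈ₘ x → z ∈ₘ y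

/-- `x = ∅`. -/
def IsEmptySet (x : M) : Prop := ∀ z, ¬ z ∈ₘ x

/-- `s = x ∪ {x}`. -/
def IsSucc (s x : M) : Prop := ∀ z, z ∈ₘ s ↔ z ∈ₘ x ∨ z = x

/-- `∅ ∈ w`, and `w` is closed under `x ↦ x ∪ {x}`. -/
def IsInductive (w : M) : Prop :=
  (∃ y, y ∈ₘ w ∧ IsEmptySet y) ∧ ∀ x, x ∈ₘ w → ∃ s, s ∈ₘ w ∧ IsSucc s x

/-- `w = ω`, the least inductive set. -/
def IsOmega (w : M) : Prop := IsInductive w ∧ ∀ v, IsInductive v → Sub w v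

/-- `z = {x, y}`. -/
def IsUPair (z x y : M) : Prop := ∀ w, w ∈ₘ z ↔ w = x ∨ w = y

/-- `p = ⟨x, y⟩` (Kuratowski pair). -/
def IsOPair (p x y : M) : Prop := ∀ z, z ∈ₘ p ↔ IsUPair z x x ∨ IsUPair z x y

/-- `⟨x, y⟩ ∈ f`; for a function `f` this says `f(x) = y`. -/
def App (f x y : M) : Prop := ∃ p, p ∈ₘ f ∧ IsOPair p x y

/-- `f` is a function with domain `d`. -/
def IsFunOn (f d : M) : Prop :=
  (∀ p, p ∈ₘ f → ∃ x y, x ∈ₘ d ∧ IsOPair p x y) ∧ ∀ x, x ∈ₘ d → ∃! y, App f x y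

/-- `p` is the power set of `x`. -/
def IsPowerset (p x : M) : Prop := ∀ y, y ∈ₘ p ↔ Sub y x

/-- `x` is transitive. -/
def IsTrans (x : M) : Prop := ∀ y, y ∈ₘ x → Sub y x

/-- `x` is a (von Neumann) ordinal: a transitive set of transitive sets. -/
def IsOrd (x : M) : Prop := IsTrans x ∧ ∀ y, y ∈ₘ x → IsTrans y

/-- `v = V_α`: there is a function `f` on `α + 1` with `f(β) = ⋃ {𝒫(f(γ)) : γ < β}` for all
`β ≤ α`, and `v = f(α)`. -/
def IsV (v α : M) : Prop :=
  IsOrd α ∧ ∃ s f, IsSucc s α ∧ IsFunOn f s ∧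
    (∀ β y, β ∈ₘ s → App f β y → ∀ x, x ∈ₘ y ↔ ∃ γ z, γ ∈ₘ β ∧ App f γ z ∧ Sub x z) ∧
    App f α v

/-- `α` is the rank of `x`: the least ordinal with `x ⊆ V_α`. -/
def IsRank (x α : M) : Prop :=
  (∃ v, IsV v α ∧ Sub x v) ∧ ∀ β v, β ∈ₘ α → IsV v β → ¬ Sub x v

/-- The rank of `x` is at most the rank of `y`. -/
def RankLE (x y : M) : Prop :=
  ∃ α β, IsRank x α ∧ IsRank y β ∧ (α ∈ₘ β ∨ α = β)

/-- `κ` is a strongly inaccessible cardinal: an ordinal above `ω` which is regular (functions from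
smaller ordinals into `κ` are bounded) and a strong limit (the power set of any smaller ordinal
injects into a smaller ordinal). -/
def IsStronglyInaccessible (κ : M) : Prop :=
  IsOrd κ ∧ (∃ w, IsOmega w ∧ w ∈ₘ κ) ∧
  (∀ α f, α ∈ₘ κ → IsFunOn f α → (∀ x y, App f x y → y ∈ₘ κ) →
    ∃ β, β ∈ₘ κ ∧ ∀ x y, App f x y → y ∈ₘ β) ∧
  (∀ α, α ∈ₘ κ → ∃ β p f, β ∈ₘ κ ∧ IsPowerset p α ∧ IsFunOn f p ∧
    (∀ x y, App f x y → y ∈ₘ β) ∧ ∀ x x' y, App f x y → App f x' y → x = x')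

/-- `U` is a nonprincipal ultrafilter on `ω`. -/
def IsNonprincipalUltrafilter (U : M) : Prop :=
  ∃ w, IsOmega w ∧
    (∀ X, X ∈ₘ U → Sub X w) ∧
    w ∈ₘ U ∧
    (∀ X, IsEmptySet X → ¬ X ∈ₘ U) ∧
    (∀ X Y, X ∈ₘ U → Sub X Y → Sub Y w → Y ∈ₘ U) ∧
    (∀ X Y Z, X ∈ₘ U → Y ∈ₘ U → (∀ n, n ∈ₘ Z ↔ n ∈ₘ X ∧ n ∈ₘ Y) → Z ∈ₘ U) ∧
    (∀ X Y, Sub X w → (∀ n, n ∈ₘ Y ↔ n ∈ₘ w ∧ ¬ n ∈ₘ X) → X ∈ₘ U ∨ Y ∈ₘ U) ∧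
    ¬ ∃ n, n ∈ₘ w ∧ ∀ X, X ∈ₘ U ↔ Sub X w ∧ n ∈ₘ X

/-- `f` is a function with domain `ω`. -/
def IsOmegaSeq (f : M) : Prop := ∃ w, IsOmega w ∧ IsFunOn f w

/-- `f` is the function on `ω` with constant value `k`. -/
def IsConstSeq (f k : M) : Prop :=
  ∃ w, IsOmega w ∧ ∀ p, p ∈ₘ f ↔ ∃ n, n ∈ₘ w ∧ IsOPair p n k

variable (M) in
/-- `M` is `ω`-standard: its natural numbers, ordered by its membership relation, are isomorphic to
the true natural numbers. -/
def OmegaStandard : Prop :=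
  ∃ w : M, IsOmega w ∧
    Nonempty ((fun a b : {n : M // n ∈ₘ w} => a.1 ∈ₘ b.1) ≃r ((· < ·) : ℕ → ℕ → Prop))

end Internal

/-! ### The internal ultrapower -/

section Ultrapower

variable {K : Type u} [LSet.Structure K]

/-- `{n ∈ ω : f(n) = g(n)} ∈ U`, in the sense of `K`. -/
def EqMod (U f g : K) : Prop :=
  ∃ w X, IsOmega w ∧ X ∈ₘ U ∧ ∀ n, n ∈ₘ X ↔ n ∈ₘ w ∧ ∃ y, App f n y ∧ App g n y

/-- `{n ∈ ω : f(n) ∈ g(n)} ∈ U`, in the sense of `K`. -/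
def MemMod (U f g : K) : Prop :=
  ∃ w X, IsOmega w ∧ X ∈ₘ U ∧
    ∀ n, n ∈ₘ X ↔ n ∈ₘ w ∧ ∃ y z, App f n y ∧ App g n z ∧ y ∈ₘ z

/-- The universe of the internal ultrapower of `K` modulo `U`: the classes `[f]_U` of those `f` in
`K` that are functions with domain `ω` in the sense of `K`. When `K` is a model of `ZF` and `U` is an
ultrafilter on `ω` in `K`, `EqMod U` is an equivalence relation, and `MemMod U` respects it. -/
def InternalUltrapower (U : K) : Type u :=
  Quot fun f g : {f : K // IsOmegaSeq f} => EqMod U f.1 g.1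

/-- The class `[f]_U`. -/
def InternalUltrapower.mk (U : K) (f : {f : K // IsOmegaSeq f}) : InternalUltrapower U :=
  Quot.mk _ f

/-- `[f]_U ∈ [g]_U` iff `{n ∈ ω : f(n) ∈ g(n)} ∈ U` in the sense of `K`. -/
instance (U : K) : LSet.Structure (InternalUltrapower U) where
  funMap := fun f => nomatch f
  RelMap := fun r => match r with
    | SetRel.mem => fun x => ∃ f g : {f : K // IsOmegaSeq f},
        x 0 = InternalUltrapower.mk U f ∧ x 1 = InternalUltrapower.mk U g ∧ MemMod U f.1 g.1

end Ultrapower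

/-! ### Definability, and the refuted claim

In what follows `i : K ↪ M` is the map along which the universe of `K` is regarded as a subset of the
universe of `M`. It need not respect membership. -/

section Claim

/-- The `LSetP`-structure `(K, P)`. -/
@[reducible]
def expandP {K : Type u} [LSet.Structure K] (P : Set K) : LSetP.Structure K where
  funMap := fun f => nomatch f
  RelMap := fun r => match r with
    | SetPredRel.mem => fun x => x 0 ∈ₘ x 1
    | SetPredRel.P => fun x => x 0 ∈ P

/-- `(K, P) ⊨ ZF(P)`. -/
def ModelsZFP {K : Type u} [LSet.Structure K] (P : Set K) : Prop :=
  @Theory.Model LSetP K (expandP P) (ZF memSymP)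

variable {K M : Type u} [LSet.Structure K] [LSet.Structure M] (i : K ↪ M)

/-- The `LPair`-structure `(M, K)`, with universe `M`. -/
@[reducible]
def pairStructure : LPair.Structure M where
  funMap := fun f => nomatch f
  RelMap := fun r => match r with
    | PairRel.memM => fun x => x 0 ∈ₘ x 1
    | PairRel.univK => fun x => ∃ a, i a = x 0
    | PairRel.memK => fun x => ∃ a b, i a = x 0 ∧ i b = x 1 ∧ a ∈ₘ b

/-- The binary relation `R` on `M` is `(M, K)`-definable (with parameters). -/
def PairDefinable (R : Set (M × M)) : Prop :=
  @Set.Definable₂ M Set.univ LPair (pairStructure i) R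

/-- `M` is conservative over `K`: the intersection with `K` of every parametrically definable subset
of `M` is parametrically definable in `K`. -/
def Conservative : Prop :=
  ∀ D : Set M, Set.univ.Definable₁ LSet D → Set.univ.Definable₁ LSet (i ⁻¹' D)

/-- The hypotheses of the claim: `M` and `K` are models of `ZF`, and `(K, D ∩ K) ⊨ ZF(P)` for every
parametrically `M`-definable `D ⊆ M`. -/
def ClaimHypotheses : Prop :=
  M ⊨ ZF memSym ∧ K ⊨ ZF memSym ∧
    ∀ D : Set M, Set.univ.Definable₁ LSet D → ModelsZFP (i ⁻¹' D)

/-- Condition (1): there is an `(M, K)`-definable isomorphism between `K` and `(V_κ, ∈)` of `M` for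
some strongly inaccessible cardinal `κ` of `M`. -/
def ClaimCondition1 : Prop :=
  ∃ κ v : M, IsStronglyInaccessible κ ∧ IsV v κ ∧
    ∃ F : K → M, Function.Injective F ∧ Set.range F = {x | x ∈ₘ v} ∧
      (∀ a b, a ∈ₘ b ↔ F a ∈ₘ F b) ∧ PairDefinable i {q | ∃ a, q = (i a, F a)}

/-- Condition (2): there is an `(M, K)`-definable isomorphism between `K` and `M`. -/
def ClaimCondition2 : Prop :=
  ∃ F : K → M, Function.Bijective F ∧
    (∀ a b, a ∈ₘ b ↔ F a ∈ₘ F b) ∧ PairDefinable i {q | ∃ a, q = (i a, F a)}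

/-- Condition (3): there is an `(M, K)`-definable embedding of `M` onto a proper rank initial segment
of `K`, i.e. onto a proper subset of `K` that contains, with each of its elements, every element of
`K` of at most the same rank. -/
def ClaimCondition3 : Prop :=
  ∃ F : M → K, Function.Injective F ∧ (∀ a b, a ∈ₘ b ↔ F a ∈ₘ F b) ∧
    (∀ x y : K, y ∈ Set.range F → RankLE x y → x ∈ Set.range F) ∧
    Set.range F ≠ Set.univ ∧ PairDefinable i {q | ∃ m, q = (m, i (F m))}

/-- Exactly one of three propositions holds. -/
def ExactlyOne (p q r : Prop) : Prop :=
  (p ∧ ¬ q ∧ ¬ r) ∨ (¬ p ∧ q ∧ ¬ r) ∨ (¬ p ∧ ¬ q ∧ r)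

/-- The refuted claim: whenever `M` and `K` satisfy the hypotheses, with the universe of `K` a subset
of the universe of `M`, exactly one of the three conditions holds. -/
def IncorrectClaim : Prop :=
  ∀ (M : Type u) [LSet.Structure M] (K : Set M) [LSet.Structure K],
    ClaimHypotheses (Function.Embedding.subtype (· ∈ K)) →
      ExactlyOne (ClaimCondition1 (Function.Embedding.subtype (· ∈ K)))
        (ClaimCondition2 (Function.Embedding.subtype (· ∈ K)))
        (ClaimCondition3 (Function.Embedding.subtype (· ∈ K)))

end Claim

end SetModel

namespace SetModel

/-! ### Parametrically definable predicates -/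

section Definability

/-! Everything about the ultrapower is visible inside `K`. For representatives `f`, truth of `φ` at
the classes of `f` in the ultrapower is equivalent to the statement of `K` that `{n ∈ ω : φ(f(n))}`
belongs to `U` (Łoś, `realize_mk_iff`). Separation in `K` makes this collection a set, and choice in
`K` supplies the function needed in the quantifier case. Applied to constant functions, this gives
elementarity of `j`. Applied with one constant argument `k`, it defines `D ∩ K` in `K` from
representatives of the parameters of `D`, which is conservativity
(`conservative_ultrapowerEmbedding`). Expanding `K` by a predicate that it already defines creates
no new instances of the schemes, so `ZF(P)` holds (`modelsZFP_of_dfn`). The class of the identity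
function is a natural number of the ultrapower lying above every `j(n)`, because a nonprincipal `U`
contains no finite set (`inU_mem`). Hence the ultrapower is not `ω`-standard
(`not_omegaStandard_ultrapower`). Each of the three conditions would yield a membership isomorphism
of one model onto a transitive class of the other that contains its `ω`. Such an isomorphism carries
`ω` to `ω` (`IsTransitiveEmbedding.map_omega`), so both models or neither would be `ω`-standard, a
contradiction. Nearly all of the work takes place inside `K`, where each use of a scheme needs a
definable predicate. The classes `Dfn` and `DMap` let instance search produce the defining formulas
from the shape of a predicate. -/

/-- `X` is a context over `K`: its points are coded by tuples of elements of `K`. -/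
class Ctx (K X : Type u) where
  /-- the index set of the coordinates -/
  Idx : Type
  /-- the coordinates of a point -/
  val : X → Idx → K

instance (K : Type u) : Ctx K K := ⟨Unit, fun x _ => x⟩

instance (K : Type u) : Ctx K PUnit.{u + 1} := ⟨Empty, fun _ i => i.elim⟩

instance (K X Y : Type u) [Ctx K X] [Ctx K Y] : Ctx K (X × Y) :=
  ⟨Ctx.Idx K X ⊕ Ctx.Idx K Y, fun p => Sum.elim (Ctx.val p.1) (Ctx.val p.2)⟩

/-- `P` is definable with parameters by a formula of set theory. The instances carry `no_index`
because the discrimination tree would index eta-reduced predicates under another key. -/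
class Dfn (K : Type u) [LSet.Structure K] {X : Type u} [Ctx K X] (P : X → Prop) : Prop where
  exists_formula : ∃ φ : LSet.Formula (K ⊕ Ctx.Idx K X),
    ∀ x, φ.Realize (Sum.elim id (Ctx.val x)) ↔ P x

/-- `f` is definable with parameters: substitution of `f` preserves definability. -/
class DMap (K : Type u) [LSet.Structure K] {X Y : Type u} [Ctx K X] [Ctx K Y] (f : X → Y) :
    Prop where
  subst : ∀ (Z : Type u) [Ctx K Z] (P : Y × Z → Prop), Dfn K P →
    Dfn K (fun p : X × Z => P (f p.1, p.2))

variable {K : Type u} [LSet.Structure K] {X Y Z : Type u} [Ctx K X] [Ctx K Y] [Ctx K Z]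

theorem Dfn.congr {P Q : X → Prop} (hP : Dfn K P) (h : ∀ x, Q x ↔ P x) : Dfn K Q := by
  have : Q = P := funext fun x => propext (h x)
  rwa [this]

/-- Renaming free variables suffices when every coordinate of `f x` is either a fixed parameter or a
coordinate of `x`. This is the only place where substitution touches syntax directly. -/
theorem Dfn.relabel {P : Y → Prop} (hP : Dfn K P) {f : X → Y}
    (σ : Ctx.Idx K Y → K ⊕ Ctx.Idx K X)
    (h : ∀ x i, Ctx.val (f x) i = Sum.elim id (Ctx.val x) (σ i)) :
    Dfn K (fun x => P (f x)) := by
  obtain ⟨φ, hφ⟩ := hP.exists_formula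
  refine ⟨⟨φ.relabel (Sum.elim Sum.inl σ), fun x => ?_⟩⟩
  rw [Formula.realize_relabel, ← hφ]
  have : (Sum.elim id (Ctx.val x) ∘ Sum.elim Sum.inl σ : K ⊕ Ctx.Idx K Y → K) =
      Sum.elim id (Ctx.val (f x)) := by
    funext i
    rcases i with i | i
    · rfl
    · simp [h]
  rw [this]

theorem Dfn.comp {P : Y → Prop} (hP : Dfn K P) (f : X → Y) [hf : DMap K f] :
    Dfn K (fun x => P (f x)) := by
  have h1 : Dfn K (fun p : Y × PUnit.{u + 1} => P p.1) :=
    hP.relabel (f := Prod.fst) (fun i => Sum.inr (Sum.inl i)) (fun x i => rfl)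
  exact (hf.subst PUnit _ h1).relabel (f := fun x : X => (x, PUnit.unit))
    (Sum.elim Sum.inr Empty.elim) (by rintro x (i | i); exacts [rfl, i.elim])

instance (priority := 2000) DMap.id : DMap K (no_index (fun x : X => x)) := ⟨fun _ _ _ h => h⟩

theorem DMap.comp {g : Y → Z} (hg : DMap K g) {f : X → Y} (hf : DMap K f) :
    DMap K (fun x => g (f x)) :=
  ⟨fun W _ P hP => hf.subst W _ (hg.subst W P hP)⟩

instance DMap.fst {f : X → Y × Z} [hf : DMap K f] : DMap K (no_index (fun x => (f x).1)) :=
  DMap.comp (g := Prod.fst) ⟨fun W _ P hP => hP.relabel (f := fun p : (Y × Z) × W => (p.1.1, p.2))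
    (Sum.elim (fun i => Sum.inr (Sum.inl (Sum.inl i))) (fun i => Sum.inr (Sum.inr i)))
    (by rintro x (i | i) <;> rfl)⟩ hf

instance DMap.snd {f : X → Y × Z} [hf : DMap K f] : DMap K (no_index (fun x => (f x).2)) :=
  DMap.comp (g := Prod.snd) ⟨fun W _ P hP => hP.relabel (f := fun p : (Y × Z) × W => (p.1.2, p.2))
    (Sum.elim (fun i => Sum.inr (Sum.inl (Sum.inr i))) (fun i => Sum.inr (Sum.inr i)))
    (by rintro x (i | i) <;> rfl)⟩ hf

instance (priority := 1500) DMap.const (c : Y) : DMap K (no_index (fun _ : X => c)) :=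
  ⟨fun W _ P hP => hP.relabel (f := fun p : X × W => (c, p.2))
    (Sum.elim (fun i => Sum.inl (Ctx.val c i)) (fun i => Sum.inr (Sum.inr i)))
    (by rintro x (i | i) <;> rfl)⟩

/-- The spare context in `DMap` is what permits two successive substitutions: `f` is substituted
while the second component is carried along, then `g`, and the two copies of `x` are identified at
the end. -/
theorem DMap.prodMk {f : X → Y} {g : X → Z} [hf : DMap K f] [hg : DMap K g] :
    DMap K (fun x => (f x, g x)) := by
  constructor
  intro W _ P hP
  have h1 : Dfn K (fun q : Y × (Z × W) => P ((q.1, q.2.1), q.2.2)) :=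
    hP.relabel (f := fun q : Y × (Z × W) => ((q.1, q.2.1), q.2.2))
      (Sum.elim (Sum.elim (fun i => Sum.inr (Sum.inl i)) (fun i => Sum.inr (Sum.inr (Sum.inl i))))
        (fun i => Sum.inr (Sum.inr (Sum.inr i))))
      (by rintro x ((i | i) | i) <;> rfl)
  have h2 := hf.subst (Z × W) _ h1
  have h3 : Dfn K (fun q : Z × (X × W) => P ((f q.2.1, q.1), q.2.2)) :=
    h2.relabel (f := fun q : Z × (X × W) => (q.2.1, (q.1, q.2.2)))
      (Sum.elim (fun i => Sum.inr (Sum.inr (Sum.inl i)))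
        (Sum.elim (fun i => Sum.inr (Sum.inl i)) (fun i => Sum.inr (Sum.inr (Sum.inr i)))))
      (by rintro x (i | i | i) <;> rfl)
  have h4 := hg.subst (X × W) _ h3
  exact h4.relabel (f := fun q : X × W => (q.1, (q.1, q.2)))
      (Sum.elim (fun i => Sum.inr (Sum.inl i)) Sum.inr)
      (by rintro x (i | i | i) <;> rfl)

theorem Dfn.comp₂ {R : K → K → Prop} (hR : Dfn K (fun p : K × K => R p.1 p.2)) (f g : X → K)
    [DMap K f] [DMap K g] : Dfn K (fun x => R (f x) (g x)) :=
  hR.comp (fun x => (f x, g x)) (hf := .prodMk)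

theorem Dfn.comp₃ {R : K → K → K → Prop} (hR : Dfn K (fun p : (K × K) × K => R p.1.1 p.1.2 p.2))
    (f g h : X → K) [DMap K f] [DMap K g] [DMap K h] : Dfn K (fun x => R (f x) (g x) (h x)) :=
  hR.comp (fun x => ((f x, g x), h x)) (hf := .prodMk (hf := .prodMk))

/-- Allowing an arbitrary inner map `g` turns a hypothesis on `f` into a local instance that
instance search can use under further quantified variables. `DMap.pull₂` and `Dfn.pull₂` serve the
same purpose for two arguments. -/
theorem DMap.pull {f : X → Y} (hf : DMap K f) {W : Type u} [Ctx K W] (g : W → X) [hg : DMap K g] :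
    DMap K (fun w => f (g w)) := hf.comp hg

theorem DMap.pull₂ {F : X → Z → Y} (hF : DMap K (fun p : X × Z => F p.1 p.2)) {W : Type u} [Ctx K W]
    (f : W → X) (g : W → Z) [hf : DMap K f] [hg : DMap K g] : DMap K (fun w => F (f w) (g w)) :=
  hF.comp (f := fun w => (f w, g w)) .prodMk

theorem Dfn.pull₂ {P : X → Y → Prop} (hP : Dfn K (fun p : X × Y => P p.1 p.2)) {W : Type u}
    [Ctx K W] (f : W → X) (g : W → Y) [DMap K f] [DMap K g] : Dfn K (fun w => P (f w) (g w)) :=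
  hP.comp (fun w => (f w, g w)) (hf := .prodMk)

instance Dfn.mem {f g : X → K} [DMap K f] [DMap K g] : Dfn K (no_index (fun x => f x ∈ₘ g x)) := by
  refine Dfn.comp₂ ⟨⟨Relations.formula₂ memSym (Term.var (Sum.inr (Sum.inl ())))
    (Term.var (Sum.inr (Sum.inr ()))), fun x => ?_⟩⟩ f g
  rw [Formula.realize_rel₂]
  rfl

instance Dfn.eq {f g : X → K} [DMap K f] [DMap K g] : Dfn K (no_index (fun x => f x = g x)) := by
  refine Dfn.comp₂ ⟨⟨Term.equal (Term.var (Sum.inr (Sum.inl ())))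
    (Term.var (Sum.inr (Sum.inr ()))), fun x => ?_⟩⟩ f g
  rw [Formula.realize_equal]
  rfl

instance (priority := 1500) Dfn.const (p : Prop) : Dfn K (no_index (fun _ : X => p)) := by
  by_cases h : p
  · exact ⟨⟨⊤, fun x => by simp [h]⟩⟩
  · exact ⟨⟨⊥, fun x => by simp [h]⟩⟩

instance Dfn.imp {P Q : X → Prop} [hP : Dfn K P] [hQ : Dfn K Q] : Dfn K (no_index (fun x => P x → Q x)) := by
  obtain ⟨φ, hφ⟩ := hP.exists_formula
  obtain ⟨ψ, hψ⟩ := hQ.exists_formula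
  exact ⟨⟨φ.imp ψ, fun x => by rw [Formula.realize_imp, hφ, hψ]⟩⟩

instance Dfn.not {P : X → Prop} [hP : Dfn K P] : Dfn K (no_index (fun x => ¬ P x)) :=
  Dfn.imp (Q := fun _ => False)

instance Dfn.and {P Q : X → Prop} [hP : Dfn K P] [hQ : Dfn K Q] : Dfn K (no_index (fun x => P x ∧ Q x)) :=
  Dfn.congr (P := fun x => ¬ (P x → ¬ Q x)) inferInstance (fun x => by tauto)

instance Dfn.or {P Q : X → Prop} [hP : Dfn K P] [hQ : Dfn K Q] : Dfn K (no_index (fun x => P x ∨ Q x)) :=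
  Dfn.congr (P := fun x => ¬ P x → Q x) inferInstance (fun x => by tauto)

instance Dfn.iff {P Q : X → Prop} [hP : Dfn K P] [hQ : Dfn K Q] : Dfn K (no_index (fun x => P x ↔ Q x)) :=
  Dfn.congr (P := fun x => (P x → Q x) ∧ (Q x → P x)) inferInstance (fun x => by tauto)

instance Dfn.ne {f g : X → K} [DMap K f] [DMap K g] : Dfn K (no_index (fun x => f x ≠ g x)) :=
  Dfn.not (P := fun x => f x = g x)

instance Dfn.ex {Q : X → K → Prop} [hQ : Dfn K (fun p : X × K => Q p.1 p.2)] :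
    Dfn K (no_index (fun x => ∃ y, Q x y)) := by
  obtain ⟨φ, hφ⟩ := hQ.exists_formula
  refine ⟨⟨Formula.iExs Unit (φ.relabel (Sum.elim (fun k => Sum.inl (Sum.inl k))
    (Sum.elim (fun i => Sum.inl (Sum.inr i)) Sum.inr))), fun x => ?_⟩⟩
  rw [Formula.realize_iExs]
  constructor
  · rintro ⟨y, hy⟩
    refine ⟨y (), (hφ (x, y ())).1 ?_⟩
    rw [Formula.realize_relabel] at hy
    refine (iff_of_eq (congrArg φ.Realize (funext fun i => ?_))).1 hy
    rcases i with i | i | i <;> rfl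
  · rintro ⟨y, hy⟩
    refine ⟨fun _ => y, ?_⟩
    rw [Formula.realize_relabel]
    refine (iff_of_eq (congrArg φ.Realize (funext fun i => ?_))).1 ((hφ (x, y)).2 hy)
    rcases i with i | i | i <;> rfl

instance Dfn.all {Q : X → K → Prop} [hQ : Dfn K (fun p : X × K => Q p.1 p.2)] :
    Dfn K (no_index (fun x => ∀ y, Q x y)) :=
  Dfn.congr (P := fun x => ¬ ∃ y, ¬ Q x y) inferInstance (fun x => by simp)

instance Dfn.exUnique {Q : X → K → Prop} [hQ : Dfn K (fun p : X × K => Q p.1 p.2)] :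
    Dfn K (no_index (fun x => ∃! y, Q x y)) := by
  have h := @hQ.pull₂
  unfold ExistsUnique
  infer_instance

/-- A function whose graph is definable is definable. -/
theorem DMap.of_graph {f : X → K} (h : Dfn K (fun p : X × K => p.2 = f p.1)) : DMap K f := by
  constructor
  intro W _ P hP
  have h1 : Dfn K (fun p : (X × W) × K => p.2 = f p.1.1) :=
    h.comp (fun p : (X × W) × K => (p.1.1, p.2)) (hf := .prodMk)
  have h2 : Dfn K (fun p : (X × W) × K => P (p.2, p.1.2)) :=
    hP.comp (fun p : (X × W) × K => (p.2, p.1.2)) (hf := .prodMk)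
  -- A function symbol is eliminated by quantifying over its value.
  refine Dfn.congr (P := fun p : X × W => ∃ y, y = f p.1 ∧ P (y, p.2)) inferInstance ?_
  simp

theorem DMap.of_iff {f : X → K} {Q : X → K → Prop} [h : Dfn K (fun p : X × K => Q p.1 p.2)]
    (hf : ∀ x y, y = f x ↔ Q x y) : DMap K f :=
  DMap.of_graph (h.congr fun p => hf p.1 p.2)

/-- Satisfaction of a formula is definable in the values of its variables. -/
theorem Dfn.realize {α : Type*} {n : ℕ} (φ : LSet.BoundedFormula α n) {X : Type u} [Ctx K X]
    (f : α → X → K) (g : Fin n → X → K) (hf : ∀ a, DMap K (f a)) (hg : ∀ i, DMap K (g i)) :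
    Dfn K (fun x => φ.Realize (fun a => f a x) (fun i => g i x)) := by
  have ht : ∀ {n : ℕ} {X : Type u} [Ctx K X] (f : α → X → K) (g : Fin n → X → K)
      (_ : ∀ a, DMap K (f a)) (_ : ∀ i, DMap K (g i)) (t : LSet.Term (α ⊕ Fin n)),
      DMap K (fun x => t.realize (Sum.elim (fun a => f a x) (fun i => g i x))) := by
    intro n X _ f g hf hg t
    cases t with
    | var a => rcases a with a | i
               · exact hf a
               · exact hg i
    | func F _ => exact F.elim
  induction φ generalizing X with
  | falsum => exact Dfn.const False
  | equal t₁ t₂ =>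
    have h1 := ht f g hf hg t₁
    have h2 := ht f g hf hg t₂
    exact Dfn.eq
  | rel R ts =>
    cases R
    have h1 := ht f g hf hg (ts 0)
    have h2 := ht f g hf hg (ts 1)
    refine (Dfn.mem (K := K) (f := fun x => (ts 0).realize (Sum.elim (fun a => f a x) (fun i => g i x)))
      (g := fun x => (ts 1).realize (Sum.elim (fun a => f a x) (fun i => g i x)))).congr fun x => ?_
    refine iff_of_eq (congrArg (Structure.RelMap memSym) (funext fun i => ?_))
    fin_cases i <;> rfl
  | imp φ ψ h1 h2 =>
    have := h1 f g hf hg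
    have := h2 f g hf hg
    exact Dfn.imp
  | @all n φ h =>
    -- The bound variable becomes one more coordinate of the context, which is why the induction
    -- generalizes over `X`.
    have h' := h (X := X × K) (fun a p => f a p.1) (fun i p => Fin.snoc (α := fun _ => K) (fun i => g i p.1) p.2 i)
      (fun a => (hf a).comp inferInstance)
      (fun i => by
        induction i using Fin.lastCases with
        | last => simp only [Fin.snoc_last]; infer_instance
        | cast i => simp only [Fin.snoc_castSucc]; exact (hg i).comp inferInstance)
    exact Dfn.all (Q := fun x y => φ.Realize (fun a => f a x) (Fin.snoc (fun i => g i x) y))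

theorem Dfn.realize_formula {α : Type*} (φ : LSet.Formula α) (f : α → X → K)
    (hf : ∀ a, DMap K (f a)) : Dfn K (fun x => φ.Realize (fun a => f a x)) :=
  (Dfn.realize φ f Fin.elim0 hf fun i => i.elim0).congr fun _ =>
    iff_of_eq (congrArg (BoundedFormula.Realize φ _) (Subsingleton.elim _ _))

/-- The two notions of definability differ only in bookkeeping: `Dfn` keeps parameters as free
variables, whereas `Definable₁` uses constants for them. -/
theorem Dfn.definable₁ {D : K → Prop} (h : Dfn K D) : Set.univ.Definable₁ LSet {x | D x} := by
  obtain ⟨φ, hφ⟩ := h.exists_formula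
  refine ⟨BoundedFormula.constantsVarsEquiv.symm
    (φ.relabel (Sum.map (fun k => (⟨k, trivial⟩ : (Set.univ : Set K))) (fun _ => (0 : Fin 1)))), ?_⟩
  ext x
  change D (x 0) ↔ _
  rw [← hφ]
  simp only [Set.mem_ofPred_eq, Formula.Realize]
  rw [← BoundedFormula.realize_constantsVarsEquiv, Equiv.apply_symm_apply]
  change _ ↔ (Formula.relabel _ φ).Realize _
  rw [Formula.realize_relabel]
  apply iff_of_eq
  change Formula.Realize _ _ = _
  congr 1
  funext i
  rcases i with i | i <;> rfl

theorem exists_formula_of_definable₁ {D : Set K} (h : Set.univ.Definable₁ LSet D) :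
    ∃ φ : LSet.Formula (K ⊕ Fin 1), ∀ x, x ∈ D ↔ φ.Realize (Sum.elim id fun _ => x) := by
  obtain ⟨φ, hφ⟩ := h
  refine ⟨Formula.relabel (Sum.map Subtype.val id)
    (BoundedFormula.constantsVarsEquiv φ : LSet.Formula _), fun x => ?_⟩
  have : x ∈ D ↔ (fun _ : Fin 1 => x) ∈ Set.ofPred φ.Realize := by rw [← hφ]; rfl
  rw [this, Formula.realize_relabel]
  change BoundedFormula.Realize φ _ _ ↔ BoundedFormula.Realize _ _ _
  rw [← BoundedFormula.realize_constantsVarsEquiv]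
  apply iff_of_eq
  congr 1
  funext i
  rcases i with i | i <;> rfl

theorem dfn_of_definable₁ {D : Set K} (h : Set.univ.Definable₁ LSet D) :
    Dfn K (fun x => x ∈ D) := by
  obtain ⟨φ, hφ⟩ := exists_formula_of_definable₁ h
  refine Dfn.congr ?_ hφ
  refine (Dfn.realize_formula (K := K) (X := K) φ (Sum.elim (fun k _ => k) fun _ x => x) ?_).congr
    fun x => iff_of_eq (congrArg _ (funext fun i => ?_))
  · rintro (k | i)
    · exact DMap.const k
    · exact DMap.id
  · rcases i with i | i <;> rfl

end Definability

/-! ### Semantics of the axioms -/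

section Semantics

variable {L : FirstOrder.Language.{0, 0}} (e : L.Relations 2) {N : Type u} [L.Structure N]

theorem realize_memF {n : ℕ} (i j : Fin n) (v : Empty → N) (xs : Fin n → N) :
    (memF e i j).Realize v xs ↔ Structure.RelMap e ![xs i, xs j] := by
  simp [memF, BoundedFormula.realize_rel₂]

theorem realize_eqF {n : ℕ} (i j : Fin n) (v : Empty → N) (xs : Fin n → N) :
    (eqF L i j).Realize v xs ↔ xs i = xs j := by
  simp [eqF]

/-- The finitely many single axioms of `ZF`, for a relation `E`. -/
structure BasicZF (E : N → N → Prop) : Prop where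
  ext : ∀ x y, (∀ z, E z x ↔ E z y) → x = y
  foundation : ∀ x, (∃ y, E y x) → ∃ y, E y x ∧ ¬ ∃ z, E z x ∧ E z y
  pairing : ∀ x y, ∃ z, ∀ w, E w z ↔ w = x ∨ w = y
  union : ∀ x, ∃ t, ∀ z, E z t ↔ ∃ y, E y x ∧ E z y
  powerset : ∀ x, ∃ p, ∀ y, E y p ↔ ∀ z, E z y → E z x
  infinity : ∃ w, (∃ y, E y w ∧ ∀ z, ¬ E z y) ∧
    ∀ x, E x w → ∃ s, E s w ∧ ∀ z, E z s ↔ E z x ∨ z = x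

theorem realize_axExtensionality : N ⊨ axExtensionality e ↔
    ∀ x y : N, (∀ z, Structure.RelMap e ![z, x] ↔ Structure.RelMap e ![z, y]) → x = y := by
  simp only [axExtensionality, Sentence.Realize, Formula.Realize, BoundedFormula.realize_all,
    BoundedFormula.realize_imp, BoundedFormula.realize_iff, realize_memF, realize_eqF]
  rfl

theorem realize_axFoundation : N ⊨ axFoundation e ↔
    ∀ x : N, (∃ y, Structure.RelMap e ![y, x]) →
      ∃ y, Structure.RelMap e ![y, x] ∧
        ¬ ∃ z, Structure.RelMap e ![z, x] ∧ Structure.RelMap e ![z, y] := by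
  simp only [axFoundation, Sentence.Realize, Formula.Realize, BoundedFormula.realize_all,
    BoundedFormula.realize_imp, BoundedFormula.realize_ex, BoundedFormula.realize_inf,
    BoundedFormula.realize_not, realize_memF]
  rfl

theorem realize_axPairing : N ⊨ axPairing e ↔
    ∀ x y : N, ∃ z, ∀ w, Structure.RelMap e ![w, z] ↔ w = x ∨ w = y := by
  simp only [axPairing, Sentence.Realize, Formula.Realize, BoundedFormula.realize_all,
    BoundedFormula.realize_iff, BoundedFormula.realize_ex, BoundedFormula.realize_sup,
    realize_memF, realize_eqF]
  rfl

theorem realize_axUnion : N ⊨ axUnion e ↔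
    ∀ x : N, ∃ t, ∀ z, Structure.RelMap e ![z, t] ↔
      ∃ y, Structure.RelMap e ![y, x] ∧ Structure.RelMap e ![z, y] := by
  simp only [axUnion, Sentence.Realize, Formula.Realize, BoundedFormula.realize_all,
    BoundedFormula.realize_iff, BoundedFormula.realize_ex, BoundedFormula.realize_inf,
    realize_memF]
  rfl

theorem realize_axPowerset : N ⊨ axPowerset e ↔
    ∀ x : N, ∃ p, ∀ y, Structure.RelMap e ![y, p] ↔
      ∀ z, Structure.RelMap e ![z, y] → Structure.RelMap e ![z, x] := by
  simp only [axPowerset, Sentence.Realize, Formula.Realize, BoundedFormula.realize_all,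
    BoundedFormula.realize_iff, BoundedFormula.realize_ex, BoundedFormula.realize_imp,
    realize_memF]
  rfl

theorem realize_axInfinity : N ⊨ axInfinity e ↔
    ∃ w : N, (∃ y, Structure.RelMap e ![y, w] ∧ ∀ z, ¬ Structure.RelMap e ![z, y]) ∧
      ∀ x, Structure.RelMap e ![x, w] → ∃ s, Structure.RelMap e ![s, w] ∧
        ∀ z, Structure.RelMap e ![z, s] ↔ Structure.RelMap e ![z, x] ∨ z = x := by
  simp only [axInfinity, Sentence.Realize, Formula.Realize, BoundedFormula.realize_all,
    BoundedFormula.realize_iff, BoundedFormula.realize_ex, BoundedFormula.realize_imp,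
    BoundedFormula.realize_inf, BoundedFormula.realize_sup, BoundedFormula.realize_not,
    realize_memF, realize_eqF]
  rfl

theorem realize_axChoice : N ⊨ axChoice e ↔
    ∀ x : N, ((∀ y, Structure.RelMap e ![y, x] → ∃ z, Structure.RelMap e ![z, y]) ∧
      ∀ y, Structure.RelMap e ![y, x] → ∀ z, Structure.RelMap e ![z, x] →
        (∃ w, Structure.RelMap e ![w, y] ∧ Structure.RelMap e ![w, z]) → y = z) →
      ∃ c, ∀ y, Structure.RelMap e ![y, x] →
        ∃ w, ∀ v, Structure.RelMap e ![v, y] ∧ Structure.RelMap e ![v, c] ↔ v = w := by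
  simp only [axChoice, Sentence.Realize, Formula.Realize, BoundedFormula.realize_all,
    BoundedFormula.realize_iff, BoundedFormula.realize_ex, BoundedFormula.realize_imp,
    BoundedFormula.realize_inf, realize_memF, realize_eqF]
  rfl

/-- This separates the bounding set of a scheme from its parameters. -/
theorem forall_fin_succ_snoc {n : ℕ} {P : (Fin (n + 1) → N) → Prop} :
    (∀ xs, P xs) ↔ ∀ (p : Fin n → N) (a : N), P (Fin.snoc (α := fun _ => N) p a) := by
  refine ⟨fun h p a => h _, fun h xs => ?_⟩
  have := h (Fin.init (α := fun _ => N) xs) (xs (Fin.last n))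
  rwa [Fin.snoc_init_self] at this

theorem snoc_penultimate {n : ℕ} (xs : Fin n → N) (a b : N) (h : n < n + 2) :
    (Fin.snoc (α := fun _ => N) (Fin.snoc (α := fun _ => N) xs a : Fin (n + 1) → N) b :
      Fin (n + 2) → N) ⟨n, h⟩ = a := by
  have : (⟨n, h⟩ : Fin (n + 2)) = (Fin.last n).castSucc := rfl
  rw [this, Fin.snoc_castSucc, Fin.snoc_last]

theorem snoc_antepenultimate {n : ℕ} (xs : Fin n → N) (a b c : N) (h : n < n + 3) :
    (Fin.snoc (α := fun _ => N) (Fin.snoc (α := fun _ => N)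
      (Fin.snoc (α := fun _ => N) xs a : Fin (n + 1) → N) b :
      Fin (n + 2) → N) c : Fin (n + 3) → N) ⟨n, h⟩ = a := by
  have : (⟨n, h⟩ : Fin (n + 3)) = (Fin.last n).castSucc.castSucc := rfl
  rw [this, Fin.snoc_castSucc, Fin.snoc_castSucc, Fin.snoc_last]

theorem snoc_ultimate {n : ℕ} (xs : Fin n → N) (a : N) (h : n < n + 1) :
    (Fin.snoc (α := fun _ => N) xs a : Fin (n + 1) → N) ⟨n, h⟩ = a :=
  Fin.snoc_last _ _

/-- Valuations in the schemes are built one variable at a time; the appended form is the one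
produced by `exists_boundedFormula`. -/
theorem snoc_snoc_eq_append {n : ℕ} (p : Fin n → N) (a x : N) :
    (Fin.snoc (α := fun _ => N) (Fin.snoc (α := fun _ => N) p a : Fin (n + 1) → N) x :
      Fin (n + 2) → N) = Fin.append p ![a, x] := by
  funext i
  refine Fin.addCases (m := n) (n := 2) (fun i => ?_) (fun i => ?_) i
  · rw [Fin.append_left]
    exact (Fin.snoc_castSucc (α := fun _ => N) _ _ i.castSucc).trans
      (Fin.snoc_castSucc (α := fun _ => N) _ _ i)
  · rw [Fin.append_right]
    fin_cases i
    · exact snoc_penultimate p a x _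
    · exact snoc_ultimate _ x _

theorem snoc_snoc_snoc_eq_append {n : ℕ} (p : Fin n → N) (a x y : N) :
    (Fin.snoc (α := fun _ => N) (Fin.snoc (α := fun _ => N)
      (Fin.snoc (α := fun _ => N) p a : Fin (n + 1) → N) x :
      Fin (n + 2) → N) y : Fin (n + 3) → N) = Fin.append p ![a, x, y] := by
  funext i
  refine Fin.addCases (m := n) (n := 3) (fun i => ?_) (fun i => ?_) i
  · rw [Fin.append_left]
    exact (Fin.snoc_castSucc (α := fun _ => N) _ _ i.castSucc.castSucc).trans
      ((Fin.snoc_castSucc (α := fun _ => N) _ _ i.castSucc).trans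
        (Fin.snoc_castSucc (α := fun _ => N) _ _ i))
  · rw [Fin.append_right]
    fin_cases i
    · exact snoc_antepenultimate p a x y _
    · exact snoc_penultimate _ x y _
    · exact snoc_ultimate _ y _

/-- In the schemes the asserted set `b` is quantified before `x`, and lifting makes `φ` skip its
variable. -/
theorem realize_liftAt_snoc_snoc {n : ℕ} (φ : L.BoundedFormula Empty (n + 1)) (v : Empty → N)
    (p : Fin n → N) (b x : N) :
    (φ.liftAt 1 n).Realize v (Fin.snoc (α := fun _ => N) (Fin.snoc (α := fun _ => N) p b) x) ↔
      φ.Realize v (Fin.snoc (α := fun _ => N) p x) := by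
  rw [BoundedFormula.realize_liftAt_one (by omega)]
  apply iff_of_eq
  congr 1
  funext i
  induction i using Fin.lastCases with
  | last => simp
  | cast i => simp

theorem realize_liftAt_snoc_snoc_snoc {n : ℕ} (φ : L.BoundedFormula Empty (n + 2)) (v : Empty → N)
    (p : Fin n → N) (b x y : N) :
    (φ.liftAt 1 n).Realize v (Fin.snoc (α := fun _ => N) (Fin.snoc (α := fun _ => N)
      (Fin.snoc (α := fun _ => N) p b) x) y) ↔
      φ.Realize v (Fin.snoc (α := fun _ => N) (Fin.snoc (α := fun _ => N) p x) y) := by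
  rw [BoundedFormula.realize_liftAt_one (by omega)]
  apply iff_of_eq
  congr 1
  funext i
  induction i using Fin.lastCases with
  | last => simp
  | cast i =>
    induction i using Fin.lastCases with
    | last =>
      simp only [Function.comp, Fin.val_castSucc, Fin.val_last, lt_irrefl, if_false,
        Fin.snoc_castSucc, Fin.snoc_last]
      rw [← Fin.castSucc_succ, Fin.succ_last, Fin.snoc_castSucc, Fin.snoc_last]
    | cast i => simp

theorem realize_axSeparation {n : ℕ} (φ : L.BoundedFormula Empty (n + 2)) : N ⊨ axSeparation e φ ↔
    ∀ (p : Fin n → N) (a : N), ∃ b, ∀ x, Structure.RelMap e ![x, b] ↔ Structure.RelMap e ![x, a] ∧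
      φ.Realize default
        (Fin.snoc (α := fun _ => N) (Fin.snoc (α := fun _ => N) p a : Fin (n + 1) → N) x) := by
  unfold axSeparation
  rw [Sentence.Realize, BoundedFormula.realize_alls, forall_fin_succ_snoc]
  simp only [BoundedFormula.realize_all,
    BoundedFormula.realize_iff, BoundedFormula.realize_ex,
    BoundedFormula.realize_inf, realize_memF, realize_liftAt_snoc_snoc,
    snoc_penultimate, snoc_antepenultimate, snoc_ultimate]

theorem realize_axReplacement {n : ℕ} (φ : L.BoundedFormula Empty (n + 3)) :
    N ⊨ axReplacement e φ ↔
    ∀ (p : Fin n → N) (a : N), (∀ x, Structure.RelMap e ![x, a] → ∃ y, ∀ z, φ.Realize default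
        (Fin.snoc (α := fun _ => N) (Fin.snoc (α := fun _ => N)
          (Fin.snoc (α := fun _ => N) p a : Fin (n + 1) → N) x : Fin (n + 2) → N) z) ↔ z = y) →
      ∃ b, ∀ x, Structure.RelMap e ![x, a] → ∃ y, Structure.RelMap e ![y, b] ∧ φ.Realize default
        (Fin.snoc (α := fun _ => N) (Fin.snoc (α := fun _ => N)
          (Fin.snoc (α := fun _ => N) p a : Fin (n + 1) → N) x : Fin (n + 2) → N) y) := by
  unfold axReplacement
  rw [Sentence.Realize, BoundedFormula.realize_alls, forall_fin_succ_snoc]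
  simp only [BoundedFormula.realize_all,
    BoundedFormula.realize_iff, BoundedFormula.realize_ex, BoundedFormula.realize_imp,
    BoundedFormula.realize_inf, realize_memF, realize_eqF, realize_liftAt_snoc_snoc,
    realize_liftAt_snoc_snoc_snoc, snoc_penultimate, snoc_antepenultimate, snoc_ultimate]

theorem model_ZF_iff : N ⊨ ZF e ↔ BasicZF (fun x y : N => Structure.RelMap e ![x, y]) ∧
    (∀ (n : ℕ) (φ : L.BoundedFormula Empty (n + 2)), N ⊨ axSeparation e φ) ∧
    ∀ (n : ℕ) (φ : L.BoundedFormula Empty (n + 3)), N ⊨ axReplacement e φ := by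
  rw [Theory.model_iff]
  constructor
  · intro h
    refine ⟨⟨?_, ?_, ?_, ?_, ?_, ?_⟩, fun n φ => h _ (Or.inl (Or.inr ⟨n, φ, rfl⟩)),
      fun n φ => h _ (Or.inr ⟨n, φ, rfl⟩)⟩
    · exact (realize_axExtensionality e).1 (h _ (by simp [ZF]))
    · exact (realize_axFoundation e).1 (h _ (by simp [ZF]))
    · exact (realize_axPairing e).1 (h _ (by simp [ZF]))
    · exact (realize_axUnion e).1 (h _ (by simp [ZF]))
    · exact (realize_axPowerset e).1 (h _ (by simp [ZF]))
    · exact (realize_axInfinity e).1 (h _ (by simp [ZF]))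
  · rintro ⟨h, hs, hr⟩ σ ((hσ | ⟨n, φ, rfl⟩) | ⟨n, φ, rfl⟩)
    · rcases hσ with rfl | rfl | rfl | rfl | rfl | rfl
      · exact (realize_axExtensionality e).2 h.ext
      · exact (realize_axFoundation e).2 h.foundation
      · exact (realize_axPairing e).2 h.pairing
      · exact (realize_axUnion e).2 h.union
      · exact (realize_axPowerset e).2 h.powerset
      · exact (realize_axInfinity e).2 h.infinity
    · exact hs n φ
    · exact hr n φ

end Semantics

/-! ### Models of `ZF` -/

/-- `K` is a model of `ZF`, with Separation and Replacement for definable predicates. -/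
class ZFModel (K : Type u) [LSet.Structure K] : Prop where
  basic : BasicZF (fun x y : K => x ∈ₘ y)
  separation : ∀ (P : K → Prop) [Dfn K P] (a : K), ∃ b, ∀ x, x ∈ₘ b ↔ x ∈ₘ a ∧ P x
  replacement : ∀ (R : K → K → Prop) [Dfn K (fun p : K × K => R p.1 p.2)] (a : K),
    (∀ x, x ∈ₘ a → ∃! y, R x y) → ∃ b, ∀ x, x ∈ₘ a → ∃ y, y ∈ₘ b ∧ R x y

section Models

variable {K : Type u} [LSet.Structure K]

/-- A formula with parameters is an instance of a formula whose parameters are variables. -/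
theorem exists_boundedFormula {m : ℕ} (φ : LSet.Formula (K ⊕ Fin m)) (c : K) :
    ∃ (n : ℕ) (ψ : LSet.BoundedFormula Empty (n + m)) (p : Fin n → K),
      ∀ x : Fin m → K, ψ.Realize default (Fin.append p x) ↔ φ.Realize (Sum.elim id x) := by
  classical
  -- Including `c` guarantees a variable to which parameters not occurring in `φ` can be sent by
  -- default.
  let s : Finset (K ⊕ Fin m) := insert (Sum.inl c) φ.freeVarFinset
  let enum := s.equivFin
  let g : K ⊕ Fin m → Empty ⊕ Fin (s.card + m) :=
    Sum.elim (fun k => if h : Sum.inl k ∈ s then Sum.inr (Fin.castAdd m (enum ⟨_, h⟩))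
        else Sum.inr (Fin.castAdd m (enum ⟨Sum.inl c, by simp [s]⟩)))
      (fun i => Sum.inr (Fin.natAdd _ i))
  let p : Fin s.card → K := fun i => Sum.elim id (fun _ => c) (enum.symm i).1
  refine ⟨s.card, BoundedFormula.relabel (n := s.card + m) (k := 0) g φ, p, fun x => ?_⟩
  · rw [BoundedFormula.realize_relabel]
    -- The default values are harmless, since satisfaction depends only on the variables that occur
    -- free.
    have key : ∀ (v w : K ⊕ Fin m → K) (xs : Fin 0 → K),
        (∀ a ∈ φ.freeVarFinset, v a = w a) →
          (BoundedFormula.Realize φ v xs ↔ BoundedFormula.Realize φ w xs) := by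
      intro v w xs h
      have h1 : ∀ v : K ⊕ Fin m → K, BoundedFormula.Realize φ v xs ↔
          (φ.restrictFreeVar (Set.inclusion (s := (φ.freeVarFinset : Set (K ⊕ Fin m))) subset_rfl)).Realize
            (v ∘ (↑)) xs := fun v =>
        (BoundedFormula.realize_restrictFreeVar' subset_rfl).symm
      rw [h1, h1]
      apply iff_of_eq
      congr 1
      funext a
      exact h a.1 a.2
    rw [Formula.Realize, Subsingleton.elim (default : Fin 0 → K) (_ ∘ _)]
    apply key
    rintro (k | i) ha
    · have hk : Sum.inl k ∈ s := Finset.mem_insert_of_mem ha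
      simp [g, p, hk]
    · simp [g]

theorem zfModel_of_model (h : K ⊨ ZF memSym) : ZFModel K := by
  obtain ⟨hb, hs, hr⟩ := (model_ZF_iff memSym).1 h
  refine ⟨hb, fun P hP a => ?_, fun R hR a => ?_⟩
  · obtain ⟨φ, hφ⟩ := hP.exists_formula
    obtain ⟨n, ψ, p, hψ⟩ := exists_boundedFormula (m := 2)
      -- Position 0 holds the bounding set `a`, which the predicate ignores; `x` is at position 1.
      (φ.relabel (Sum.map id fun _ => (1 : Fin 2))) a
    obtain ⟨b, hb⟩ := (realize_axSeparation memSym ψ).1 (hs n ψ) p a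
    refine ⟨b, fun x => (hb x).trans (and_congr Iff.rfl ?_)⟩
    rw [snoc_snoc_eq_append, hψ, Formula.realize_relabel, ← hφ]
    refine iff_of_eq (congrArg φ.Realize (funext fun i => ?_))
    rcases i with i | i <;> rfl
  · obtain ⟨φ, hφ⟩ := hR.exists_formula
    obtain ⟨n, ψ, p, hψ⟩ := exists_boundedFormula (m := 3)
      (φ.relabel (Sum.map id (Sum.elim (fun _ => (1 : Fin 3)) (fun _ => (2 : Fin 3))))) a
    have h := (realize_axReplacement memSym ψ).1 (hr n ψ) p a
    have key : ∀ x y, R x y ↔ ψ.Realize default (Fin.snoc (α := fun _ => K)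
        (Fin.snoc (α := fun _ => K) (Fin.snoc (α := fun _ => K) p a : Fin (n + 1) → K) x :
          Fin (n + 2) → K) y) := by
      intro x y
      rw [snoc_snoc_snoc_eq_append, hψ, Formula.realize_relabel]
      refine (hφ (x, y)).symm.trans (iff_of_eq (congrArg φ.Realize (funext fun i => ?_)))
      rcases i with i | i | i <;> rfl
    simp only [← key] at h
    intro h'
    refine h fun x hx => ?_
    obtain ⟨y, hy, hy'⟩ := h' x hx
    exact ⟨y, fun z => ⟨fun hz => hy' z hz, fun hz => hz ▸ hy⟩⟩

/-- Satisfaction of a formula in `(K, P)` is definable in `K` when `P` is. -/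
theorem Dfn.realize_expandP {P : K → Prop} (hP : Dfn K P) {n : ℕ}
    (φ : LSetP.BoundedFormula Empty n) {X : Type u} [Ctx K X] (g : Fin n → X → K)
    (hg : ∀ i, DMap K (g i)) :
    Dfn K (fun x => @BoundedFormula.Realize LSetP K (expandP {x | P x}) Empty n φ default
      (fun i => g i x)) := by
  let _ := expandP {x | P x}
  have ht : ∀ {n : ℕ} {X : Type u} [Ctx K X] (g : Fin n → X → K)
      (_ : ∀ i, DMap K (g i)) (t : LSetP.Term (Empty ⊕ Fin n)),
      DMap K (fun x => t.realize (Sum.elim (default : Empty → K) (fun i => g i x))) := by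
    intro n X _ g hg t
    cases t with
    | var a => rcases a with a | i
               · exact a.elim
               · exact hg i
    | func F _ => exact F.elim
  induction φ generalizing X with
  | falsum => exact Dfn.const False
  | equal t₁ t₂ =>
    have h1 := ht g hg t₁
    have h2 := ht g hg t₂
    exact Dfn.eq
  | rel R ts =>
    cases R with
    | mem =>
      have h1 := ht g hg (ts 0)
      have h2 := ht g hg (ts 1)
      exact Dfn.mem (K := K) (f := fun x => (ts 0).realize (Sum.elim default (fun i => g i x)))
        (g := fun x => (ts 1).realize (Sum.elim default (fun i => g i x)))
    | P =>
      have h1 := ht g hg (ts 0)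
      exact hP.comp (fun x => (ts 0).realize (Sum.elim default (fun i => g i x)))
  | imp φ ψ h1 h2 =>
    have := h1 g hg
    have := h2 g hg
    exact Dfn.imp
  | @all n φ h =>
    have h' := h (X := X × K)
      (fun i p => Fin.snoc (α := fun _ => K) (fun i => g i p.1) p.2 i)
      (fun i => by
        induction i using Fin.lastCases with
        | last => simp only [Fin.snoc_last]; infer_instance
        | cast i => simp only [Fin.snoc_castSucc]; exact (hg i).comp inferInstance)
    exact Dfn.all (Q := fun x y => φ.Realize default (Fin.snoc (fun i => g i x) y))

/-- By `Dfn.realize_expandP`, every instance of a scheme for a formula mentioning `P` is an instance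
for a predicate definable in `K`. -/
theorem modelsZFP_of_dfn [ZFModel K] {P : K → Prop} (hP : Dfn K P) : ModelsZFP {x | P x} := by
  let _ := expandP {x | P x}
  have hsnoc : ∀ {n : ℕ} {X : Type u} [Ctx K X] (g : Fin n → X → K) (f : X → K)
      (_ : ∀ i, DMap K (g i)) (_ : DMap K f) (i : Fin (n + 1)),
      DMap K (fun x => Fin.snoc (α := fun _ => K) (fun i => g i x) (f x) i) := by
    intro n X _ g f hg hf i
    induction i using Fin.lastCases with
    | last => simpa only [Fin.snoc_last] using hf
    | cast i => simpa only [Fin.snoc_castSucc] using hg i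
  refine (model_ZF_iff memSymP).2 ⟨ZFModel.basic, fun n φ => ?_, fun n φ => ?_⟩
  · rw [realize_axSeparation]
    intro p a
    have : Dfn K (fun x : K => φ.Realize default (Fin.snoc (α := fun _ => K)
        (Fin.snoc (α := fun _ => K) p a : Fin (n + 1) → K) x)) :=
      hP.realize_expandP φ (X := K) (fun i x => Fin.snoc (α := fun _ => K)
        (Fin.snoc (α := fun _ => K) p a : Fin (n + 1) → K) x i)
        (hsnoc _ _ (fun i => DMap.const _) DMap.id)
    exact ZFModel.separation _ a
  · rw [realize_axReplacement]
    intro p a h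
    have : Dfn K (fun q : K × K => φ.Realize default (Fin.snoc (α := fun _ => K)
        (Fin.snoc (α := fun _ => K) (Fin.snoc (α := fun _ => K) p a : Fin (n + 1) → K) q.1 :
          Fin (n + 2) → K) q.2)) :=
      hP.realize_expandP φ (X := K × K) (fun i q => Fin.snoc (α := fun _ => K)
        (Fin.snoc (α := fun _ => K) (Fin.snoc (α := fun _ => K) p a : Fin (n + 1) → K) q.1 :
          Fin (n + 2) → K) q.2 i)
        (hsnoc _ _ (hsnoc _ _ (fun i => DMap.const _) inferInstance) inferInstance)
    refine ZFModel.replacement (fun x y => φ.Realize default (Fin.snoc (α := fun _ => K)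
        (Fin.snoc (α := fun _ => K) (Fin.snoc (α := fun _ => K) p a : Fin (n + 1) → K) x :
          Fin (n + 2) → K) y)) a fun x hx => ?_
    obtain ⟨y, hy⟩ := h x hx
    exact ⟨y, (hy y).2 rfl, fun z hz => (hy z).1 hz⟩

end Models

/-! ### Elementary set theory in a model of `ZF` -/

section SetOps

variable {K : Type u} [LSet.Structure K] {X Y Z : Type u} [Ctx K X] [Ctx K Y] [Ctx K Z]

instance Dfn.sub {f g : X → K} [DMap K f] [DMap K g] : Dfn K (no_index (fun x => Sub (f x) (g x))) :=
  Dfn.comp₂ (R := Sub) (by unfold Sub; infer_instance) f g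

instance Dfn.isEmptySet {f : X → K} [DMap K f] : Dfn K (no_index (fun x => IsEmptySet (f x))) :=
  Dfn.comp (P := IsEmptySet) (by unfold IsEmptySet; infer_instance) f

instance Dfn.isSucc {f g : X → K} [DMap K f] [DMap K g] : Dfn K (no_index (fun x => IsSucc (f x) (g x))) :=
  Dfn.comp₂ (R := IsSucc) (by unfold IsSucc; infer_instance) f g

instance Dfn.isInductive {f : X → K} [DMap K f] : Dfn K (no_index (fun x => IsInductive (f x))) :=
  Dfn.comp (P := IsInductive) (by unfold IsInductive; infer_instance) f

instance Dfn.isUPair {f g h : X → K} [DMap K f] [DMap K g] [DMap K h] :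
    Dfn K (no_index (fun x => IsUPair (f x) (g x) (h x))) :=
  Dfn.comp₃ (R := IsUPair) (by unfold IsUPair; infer_instance) f g h

instance Dfn.isOPair {f g h : X → K} [DMap K f] [DMap K g] [DMap K h] :
    Dfn K (no_index (fun x => IsOPair (f x) (g x) (h x))) :=
  Dfn.comp₃ (R := IsOPair) (by unfold IsOPair; infer_instance) f g h

instance Dfn.app {f g h : X → K} [DMap K f] [DMap K g] [DMap K h] :
    Dfn K (no_index (fun x => App (f x) (g x) (h x))) :=
  Dfn.comp₃ (R := App) (by unfold App; infer_instance) f g h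

instance Dfn.isFunOn {f g : X → K} [DMap K f] [DMap K g] :
    Dfn K (no_index (fun x => IsFunOn (f x) (g x))) :=
  Dfn.comp₂ (R := IsFunOn) (by unfold IsFunOn; infer_instance) f g

instance Dfn.isTrans {f : X → K} [DMap K f] : Dfn K (no_index (fun x => IsTrans (f x))) :=
  Dfn.comp (P := IsTrans) (by unfold IsTrans; infer_instance) f

instance Dfn.isOrd {f : X → K} [DMap K f] : Dfn K (no_index (fun x => IsOrd (f x))) :=
  Dfn.comp (P := IsOrd) (by unfold IsOrd; infer_instance) f

theorem isOrd_of_mem {α β : K} (h : IsOrd α) (hβ : β ∈ₘ α) : IsOrd β :=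
  ⟨h.2 β hβ, fun γ hγ => h.2 γ (h.1 β hβ γ hγ)⟩

variable [hK : ZFModel K]

instance ZFModel.nonempty : Nonempty K := ⟨hK.basic.infinity.choose⟩

theorem ext_mem {x y : K} (h : ∀ z, z ∈ₘ x ↔ z ∈ₘ y) : x = y := hK.basic.ext x y h

/-- The set of all `z` with `P z`, if there is such a set. -/
noncomputable def mkSet (P : K → Prop) : K := Classical.epsilon fun b => ∀ z, z ∈ₘ b ↔ P z

theorem mem_mkSet {P : K → Prop} (h : ∃ b, ∀ z, z ∈ₘ b ↔ P z) {z : K} : z ∈ₘ mkSet P ↔ P z :=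
  Classical.epsilon_spec h z

/-- By extensionality the graph is given by `∀ z, z ∈ y ↔ P x z`. All set operations below get their
definability from this. -/
theorem dmap_mkSet {P : X → K → Prop} [hP : Dfn K (fun p : X × K => P p.1 p.2)]
    (h : ∀ x, ∃ b, ∀ z, z ∈ₘ b ↔ P x z) : DMap K (fun x => mkSet (P x)) := by
  have h' := @hP.pull₂
  refine DMap.of_iff (Q := fun x y => ∀ z, z ∈ₘ y ↔ P x z) fun x y => ⟨?_, fun hy => ?_⟩
  · rintro rfl z
    exact mem_mkSet (h x)
  · exact ext_mem fun z => (hy z).trans (mem_mkSet (h x)).symm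

/-- `{z ∈ a : P z}` -/
noncomputable def sep (a : K) (P : K → Prop) : K := mkSet fun z => z ∈ₘ a ∧ P z

theorem mem_sep {a : K} {P : K → Prop} [Dfn K P] {z : K} : z ∈ₘ sep a P ↔ z ∈ₘ a ∧ P z :=
  mem_mkSet (hK.separation P a)

instance dmap_sep {f : X → K} {P : X → K → Prop} [hf : DMap K f]
    [hP : Dfn K (fun p : X × K => P p.1 p.2)] : DMap K (no_index (fun x => sep (f x) (P x))) := by
  have := @hf.pull
  have := @hP.pull₂
  refine dmap_mkSet (P := fun x z => z ∈ₘ f x ∧ P x z) fun x => ?_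
  have : Dfn K (P x) := hP.pull₂ (fun _ => x) (fun y : K => y)
  exact hK.separation _ _

/-- If a set contains all `z` with `P z`, then they form a set. -/
theorem exists_set_of_bounded {P : K → Prop} [Dfn K P] (a : K) (h : ∀ z, P z → z ∈ₘ a) :
    ∃ b, ∀ z, z ∈ₘ b ↔ P z :=
  ⟨sep a P, fun z => mem_sep.trans ⟨And.right, fun hz => ⟨h z hz, hz⟩⟩⟩

/-- `{x, y}` -/
noncomputable def upair (x y : K) : K := mkSet fun z => z = x ∨ z = y

theorem mem_upair {x y z : K} : z ∈ₘ upair x y ↔ z = x ∨ z = y := mem_mkSet (hK.basic.pairing x y)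

instance dmap_upair {f g : X → K} [DMap K f] [DMap K g] : DMap K (no_index (fun x => upair (f x) (g x))) :=
  DMap.pull₂ (F := upair) (dmap_mkSet (X := K × K) (P := fun p z => z = p.1 ∨ z = p.2)
    fun _ => hK.basic.pairing _ _) f g

/-- `⋃ x` -/
noncomputable def sUnion (x : K) : K := mkSet fun z => ∃ y, y ∈ₘ x ∧ z ∈ₘ y

theorem mem_sUnion {x z : K} : z ∈ₘ sUnion x ↔ ∃ y, y ∈ₘ x ∧ z ∈ₘ y := mem_mkSet (hK.basic.union x)

instance dmap_sUnion {f : X → K} [DMap K f] : DMap K (no_index (fun x => sUnion (f x))) :=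
  (dmap_mkSet (X := K) (P := fun x z => ∃ y, y ∈ₘ x ∧ z ∈ₘ y) fun _ => hK.basic.union _).pull f

/-- the power set of `x` -/
noncomputable def pow (x : K) : K := mkSet fun z => Sub z x

theorem mem_pow {x z : K} : z ∈ₘ pow x ↔ Sub z x := mem_mkSet (hK.basic.powerset x)

instance dmap_pow {f : X → K} [DMap K f] : DMap K (no_index (fun x => pow (f x))) :=
  (dmap_mkSet (X := K) (P := fun x z => Sub z x) fun _ => hK.basic.powerset _).pull f

/-- `x ∪ y` -/
noncomputable def union (x y : K) : K := sUnion (upair x y)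

theorem mem_union {x y z : K} : z ∈ₘ union x y ↔ z ∈ₘ x ∨ z ∈ₘ y := by
  simp [union, mem_sUnion, mem_upair]

instance dmap_union {f g : X → K} [DMap K f] [DMap K g] : DMap K (no_index (fun x => union (f x) (g x))) := by
  unfold union; infer_instance

/-- `x ∪ {x}` -/
noncomputable def succ (x : K) : K := union x (upair x x)

theorem mem_succ {x z : K} : z ∈ₘ succ x ↔ z ∈ₘ x ∨ z = x := by
  simp [succ, mem_union, mem_upair]

instance dmap_succ {f : X → K} [DMap K f] : DMap K (no_index (fun x => succ (f x))) := by
  unfold succ; infer_instance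

theorem isSucc_iff {s x : K} : IsSucc s x ↔ s = succ x :=
  ⟨fun h => ext_mem fun z => (h z).trans mem_succ.symm, by rintro rfl z; exact mem_succ⟩

theorem self_mem_succ (x : K) : x ∈ₘ succ x := mem_succ.2 (Or.inr rfl)

/-! ### Ordered pairs, functions and images -/

/-- the Kuratowski pair -/
noncomputable def opair (x y : K) : K := upair (upair x x) (upair x y)

instance dmap_opair {f g : X → K} [DMap K f] [DMap K g] : DMap K (no_index (fun x => opair (f x) (g x))) := by
  unfold opair; infer_instance

theorem isUPair_iff {z x y : K} : IsUPair z x y ↔ z = upair x y :=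
  ⟨fun h => ext_mem fun w => (h w).trans mem_upair.symm, by rintro rfl w; exact mem_upair⟩

theorem isOPair_iff {p x y : K} : IsOPair p x y ↔ p = opair x y := by
  simp only [IsOPair, isUPair_iff]
  exact ⟨fun h => ext_mem fun w => (h w).trans mem_upair.symm, by rintro rfl w; exact mem_upair⟩

theorem upair_self_inj {x y z : K} (h : upair x x = upair y z) : x = y ∧ x = z := by
  have h1 : y ∈ₘ upair x x := h ▸ mem_upair.2 (Or.inl rfl)
  have h2 : z ∈ₘ upair x x := h ▸ mem_upair.2 (Or.inr rfl)
  simp only [mem_upair, or_self] at h1 h2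
  exact ⟨h1.symm, h2.symm⟩

theorem opair_inj {x y x' y' : K} : opair x y = opair x' y' ↔ x = x' ∧ y = y' := by
  refine ⟨fun h => ?_, by rintro ⟨rfl, rfl⟩; rfl⟩
  have hx : x = x' := by
    have h1 : upair x x ∈ₘ opair x' y' := h ▸ mem_upair.2 (Or.inl rfl)
    rcases mem_upair.1 h1 with h1 | h1
    · exact (upair_self_inj h1).1
    · exact (upair_self_inj h1).1
  subst hx
  refine ⟨rfl, ?_⟩
  have h1 : upair x y ∈ₘ opair x y' := h ▸ mem_upair.2 (Or.inr rfl)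
  have h2 : upair x y' ∈ₘ opair x y := h ▸ mem_upair.2 (Or.inr rfl)
  have key : ∀ {a b : K}, upair x a = upair x b → b = x ∨ b = a := fun {a b} h =>
    mem_upair.1 (h ▸ mem_upair.2 (Or.inr rfl))
  rcases mem_upair.1 h1 with h1 | h1
  · obtain rfl := (upair_self_inj h1.symm).2
    rcases mem_upair.1 h2 with h2 | h2
    · exact (upair_self_inj h2.symm).2
    · exact (upair_self_inj h2.symm).2
  · rcases key h1 with h3 | h3
    · rcases key h1.symm with h4 | h4
      · rw [h3, h4]
      · exact h4
    · exact h3.symm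

theorem app_iff {f x y : K} : App f x y ↔ opair x y ∈ₘ f := by
  simp [App, isOPair_iff]

theorem app_mem_sUnion {f x y : K} (h : App f x y) : y ∈ₘ sUnion (sUnion f) :=
  mem_sUnion.2 ⟨upair x y, mem_sUnion.2 ⟨_, app_iff.1 h, mem_upair.2 (Or.inr rfl)⟩,
    mem_upair.2 (Or.inr rfl)⟩

/-- `f(x)`, if it is uniquely determined -/
noncomputable def ev (f x : K) : K := sUnion (sep (sUnion (sUnion f)) fun y => App f x y)

instance dmap_ev {f g : X → K} [hf : DMap K f] [hg : DMap K g] :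
    DMap K (no_index (fun x => ev (f x) (g x))) := by
  have := @hf.pull
  have := @hg.pull
  unfold ev; infer_instance

theorem ev_eq {f x y : K} (h : App f x y) (h' : ∀ z, App f x z → z = y) : ev f x = y := by
  refine ext_mem fun z => ?_
  rw [ev, mem_sUnion]
  constructor
  · rintro ⟨w, hw, hz⟩
    exact h' w (mem_sep.1 hw).2 ▸ hz
  · exact fun hz => ⟨y, mem_sep.2 ⟨app_mem_sUnion h, h⟩, hz⟩

theorem IsFunOn.app_iff {f d : K} (h : IsFunOn f d) {x : K} (hx : x ∈ₘ d) {y : K} :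
    App f x y ↔ y = ev f x := by
  obtain ⟨z, hz, hz'⟩ := h.2 x hx
  rw [ev_eq hz hz']
  exact ⟨hz' y, by rintro rfl; exact hz⟩

/-- Replacement as axiomatized gives only a set containing the values; Separation trims it to the
exact image. -/
theorem exists_img (a : K) (F : K → K) [hF : DMap K F] : ∃ b, ∀ y, y ∈ₘ b ↔ ∃ x, x ∈ₘ a ∧ y = F x := by
  have := @hF.pull
  obtain ⟨b, hb⟩ := hK.replacement (fun x y => y = F x) a (fun x _ => ⟨F x, rfl, fun _ h => h⟩)
  refine exists_set_of_bounded b ?_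
  rintro z ⟨x, hx, rfl⟩
  obtain ⟨y, hy, rfl⟩ := hb x hx
  exact hy

/-- `{F x : x ∈ a}` -/
noncomputable def img (a : K) (F : K → K) : K := mkSet fun y => ∃ x, x ∈ₘ a ∧ y = F x

theorem mem_img {a : K} {F : K → K} [DMap K F] {y : K} : y ∈ₘ img a F ↔ ∃ x, x ∈ₘ a ∧ y = F x :=
  mem_mkSet (exists_img a F)

instance dmap_img {f : X → K} {F : X → K → K} [hf : DMap K f]
    [hF : DMap K (fun p : X × K => F p.1 p.2)] : DMap K (no_index (fun x => img (f x) (F x))) := by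
  have := @hf.pull
  have := @hF.pull₂
  refine dmap_mkSet (P := fun x y => ∃ z, z ∈ₘ f x ∧ y = F x z) fun x => ?_
  have : DMap K (F x) := hF.pull₂ (fun _ => x) (fun y => y)
  exact exists_img _ _

/-- the function `x ↦ F x` with domain `a` -/
noncomputable def lam (a : K) (F : K → K) : K := img a fun x => opair x (F x)

theorem app_lam {a : K} {F : K → K} [DMap K F] {x y : K} : App (lam a F) x y ↔ x ∈ₘ a ∧ y = F x := by
  rw [app_iff, lam, mem_img]
  constructor
  · rintro ⟨z, hz, h⟩
    obtain ⟨rfl, rfl⟩ := opair_inj.1 h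
    exact ⟨hz, rfl⟩
  · rintro ⟨hx, rfl⟩
    exact ⟨x, hx, rfl⟩

theorem isFunOn_lam (a : K) (F : K → K) [DMap K F] : IsFunOn (lam a F) a := by
  refine ⟨fun p hp => ?_, fun x hx => ⟨F x, app_lam.2 ⟨hx, rfl⟩, fun y hy => (app_lam.1 hy).2⟩⟩
  rw [lam, mem_img] at hp
  obtain ⟨x, hx, rfl⟩ := hp
  exact ⟨x, F x, hx, isOPair_iff.2 rfl⟩

theorem ev_lam {a : K} {F : K → K} [DMap K F] {x : K} (hx : x ∈ₘ a) : ev (lam a F) x = F x :=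
  (((isFunOn_lam a F).app_iff hx).1 (app_lam.2 ⟨hx, rfl⟩)).symm

/-! ### Natural numbers -/

/-- the empty set -/
noncomputable def emptySet : K := sep (Classical.arbitrary K) fun _ => False

theorem not_mem_emptySet (x : K) : ¬ x ∈ₘ emptySet := fun h => (mem_sep.1 h).2

theorem isEmptySet_iff {x : K} : IsEmptySet x ↔ x = emptySet :=
  ⟨fun h => ext_mem fun z => iff_of_false (h z) (not_mem_emptySet z),
    by rintro rfl; exact not_mem_emptySet⟩

theorem isInductive_iff {w : K} :
    IsInductive w ↔ emptySet ∈ₘ w ∧ ∀ x, x ∈ₘ w → succ x ∈ₘ w := by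
  simp [IsInductive, isEmptySet_iff, isSucc_iff]

theorem exists_isOmega : ∃ w : K, IsOmega w := by
  obtain ⟨I, hI⟩ := hK.basic.infinity
  have hI : IsInductive I := hI
  have mem : ∀ z, z ∈ₘ sep I (fun x => ∀ v, IsInductive v → x ∈ₘ v) ↔
      ∀ v, IsInductive v → z ∈ₘ v := fun z =>
    mem_sep.trans ⟨And.right, fun h => ⟨h I hI, h⟩⟩
  refine ⟨sep I (fun x => ∀ v, IsInductive v → x ∈ₘ v), isInductive_iff.2 ⟨?_, ?_⟩, ?_⟩
  · exact (mem _).2 fun v hv => (isInductive_iff.1 hv).1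
  · exact fun x hx => (mem _).2 fun v hv => (isInductive_iff.1 hv).2 x ((mem x).1 hx v hv)
  · exact fun v hv z hz => (mem z).1 hz v hv

variable (K) in
/-- the set of natural numbers -/
noncomputable def omega : K := (exists_isOmega (K := K)).choose

theorem isOmega_omega : IsOmega (omega K) := (exists_isOmega (K := K)).choose_spec

theorem isOmega_iff {w : K} : IsOmega w ↔ w = omega K := by
  refine ⟨fun h => ext_mem fun z => ⟨?_, ?_⟩, ?_⟩
  · exact h.2 _ isOmega_omega.1 z
  · exact isOmega_omega.2 _ h.1 z
  · rintro rfl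
    exact isOmega_omega

theorem emptySet_mem_omega : (emptySet : K) ∈ₘ omega K := (isInductive_iff.1 isOmega_omega.1).1

theorem succ_mem_omega {n : K} (h : n ∈ₘ omega K) : succ n ∈ₘ omega K :=
  (isInductive_iff.1 isOmega_omega.1).2 n h

theorem omega_induction (P : K → Prop) [Dfn K P] (h0 : P emptySet)
    (hs : ∀ n, n ∈ₘ omega K → P n → P (succ n)) {n : K} (hn : n ∈ₘ omega K) : P n := by
  have : IsInductive (sep (omega K) P) := isInductive_iff.2
    ⟨mem_sep.2 ⟨emptySet_mem_omega, h0⟩, fun x hx =>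
      mem_sep.2 ⟨succ_mem_omega (mem_sep.1 hx).1, hs x (mem_sep.1 hx).1 (mem_sep.1 hx).2⟩⟩
  exact (mem_sep.1 (isOmega_omega.2 _ this n hn)).2

theorem isTrans_succ {x : K} (h : IsTrans x) : IsTrans (succ x) := by
  intro y hy z hz
  rcases mem_succ.1 hy with hy | rfl
  · exact mem_succ.2 (Or.inl (h y hy z hz))
  · exact mem_succ.2 (Or.inl hz)

theorem isTrans_of_mem_omega {n : K} (hn : n ∈ₘ omega K) : IsTrans n :=
  omega_induction (fun n => IsTrans n) (fun y hy => absurd hy (not_mem_emptySet y))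
    (fun _ _ h => isTrans_succ h) hn

theorem isTrans_omega : IsTrans (omega K) := fun n hn => by
  refine omega_induction (fun n => Sub n (omega K)) (fun y hy => absurd hy (not_mem_emptySet y))
    (fun n hn h y hy => ?_) hn
  rcases mem_succ.1 hy with hy | rfl
  · exact h y hy
  · exact hn

theorem isOrd_omega : IsOrd (omega K) := ⟨isTrans_omega, fun _ => isTrans_of_mem_omega⟩

theorem isOrd_succ {α : K} (h : IsOrd α) : IsOrd (succ α) := by
  refine ⟨isTrans_succ h.1, fun y hy => ?_⟩
  rcases mem_succ.1 hy with hy | rfl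
  · exact h.2 y hy
  · exact h.1

/-! ### Ordinals and induction -/

/-- Foundation for definable predicates on a set. -/
theorem exists_minimal (P : K → Prop) [Dfn K P] {a x : K} (hx : x ∈ₘ a) (h : P x) :
    ∃ y, y ∈ₘ a ∧ P y ∧ ∀ z, z ∈ₘ a → z ∈ₘ y → ¬ P z := by
  obtain ⟨y, hy, hy'⟩ := hK.basic.foundation (sep a P) ⟨x, mem_sep.2 ⟨hx, h⟩⟩
  exact ⟨y, (mem_sep.1 hy).1, (mem_sep.1 hy).2,
    fun z hz hzy hPz => hy' ⟨z, mem_sep.2 ⟨hz, hPz⟩, hzy⟩⟩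

/-- A counterexample `α` lies in the set `succ α`, so Foundation there yields a minimal one. -/
theorem ord_induction (P : K → Prop) [Dfn K P]
    (h : ∀ α, IsOrd α → (∀ β, β ∈ₘ α → P β) → P α) {α : K} (hα : IsOrd α) : P α := by
  by_contra hP
  obtain ⟨β, hβ, hPβ, hmin⟩ := exists_minimal (fun x => ¬ P x) (self_mem_succ α) hP
  have hβ' := isOrd_of_mem (isOrd_succ hα) hβ
  exact hPβ (h β hβ' fun γ hγ =>
    not_not.1 (hmin γ ((isOrd_succ hα).1 β hβ γ hγ) hγ))

theorem ord_trichotomy {α β : K} (hα : IsOrd α) (hβ : IsOrd β) : α ∈ₘ β ∨ α = β ∨ β ∈ₘ α := by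
  refine ord_induction (fun α => ∀ β, IsOrd β → α ∈ₘ β ∨ α = β ∨ β ∈ₘ α) ?_ hα β hβ
  intro α hα ih β hβ
  refine ord_induction (fun β => α ∈ₘ β ∨ α = β ∨ β ∈ₘ α) (fun β hβ ih' => ?_) hβ
  -- Both inductions are now available. If the inclusions hold both ways the ordinals are equal;
  -- otherwise a witness of failure is compared with the other ordinal.
  by_cases h1 : Sub α β
  · by_cases h2 : Sub β α
    · exact Or.inr (Or.inl (ext_mem fun z => ⟨h1 z, h2 z⟩))
    · simp only [Sub, not_forall] at h2
      obtain ⟨δ, hδ, hδα⟩ := h2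
      rcases ih' δ hδ with h | rfl | h
      · exact Or.inl (hβ.1 δ hδ α h)
      · exact Or.inl hδ
      · exact absurd h hδα
  · simp only [Sub, not_forall] at h1
    obtain ⟨γ, hγ, hγβ⟩ := h1
    rcases ih γ hγ β hβ with h | rfl | h
    · exact absurd h hγβ
    · exact Or.inr (Or.inr hγ)
    · exact Or.inr (Or.inr (hα.1 γ hγ β h))

end SetOps

/-! ### Recursion, ranks, collection and choice -/

section Recursion

variable {K : Type u} [LSet.Structure K] {X Y Z : Type u} [Ctx K X] [Ctx K Y] [Ctx K Z]
variable [hK : ZFModel K]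

/-- The unique `y` with `P y`, if there is one. -/
noncomputable def the (P : K → Prop) : K := sUnion (mkSet P)

theorem exists_set_of_unique {P : K → Prop} (h : ∀ y z, P y → P z → y = z) :
    ∃ b, ∀ z, z ∈ₘ b ↔ P z := by
  by_cases hP : ∃ y, P y
  · obtain ⟨y, hy⟩ := hP
    refine ⟨upair y y, fun z => ?_⟩
    rw [mem_upair, or_self]
    exact ⟨by rintro rfl; exact hy, fun hz => h z y hz hy⟩
  · exact ⟨emptySet, fun z => iff_of_false (not_mem_emptySet z) fun hz => hP ⟨z, hz⟩⟩

theorem the_eq {P : K → Prop} (h : ∀ y z, P y → P z → y = z) {y : K} (hy : P y) : the P = y := by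
  refine ext_mem fun z => ?_
  rw [the, mem_sUnion]
  constructor
  · rintro ⟨w, hw, hz⟩
    exact h w y ((mem_mkSet (exists_set_of_unique h)).1 hw) hy ▸ hz
  · exact fun hz => ⟨y, (mem_mkSet (exists_set_of_unique h)).2 hy, hz⟩

theorem dmap_the {P : X → K → Prop} [hP : Dfn K (fun p : X × K => P p.1 p.2)]
    (h : ∀ x y z, P x y → P x z → y = z) : DMap K (fun x => the (P x)) := by
  have := dmap_mkSet (P := P) fun x => exists_set_of_unique (h x)
  unfold the
  infer_instance

theorem img_congr {a : K} {F G : K → K} [DMap K F] [DMap K G] (h : ∀ x, x ∈ₘ a → F x = G x) :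
    img a F = img a G := by
  refine ext_mem fun y => ?_
  rw [mem_img, mem_img]
  exact exists_congr fun x => and_congr_right fun hx => by rw [h x hx]

/-- `f` satisfies on `s` the recursion `f(β) = G {f(γ) : γ ∈ β}`. -/
def IsRec (G : K → K) (f s : K) : Prop :=
  IsFunOn f s ∧ ∀ β, β ∈ₘ s → ev f β = G (img β fun γ => ev f γ)

/-- The function on the ordinals defined by the recursion `R(α) = G {R(γ) : γ ∈ α}`. -/
noncomputable def ordRec (G : K → K) (α : K) : K :=
  the fun y => IsOrd α ∧ ∃ f, IsRec G f (succ α) ∧ y = ev f α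

theorem IsRec.unique {G : K → K} {f g s t : K} (hs : IsOrd s) (ht : IsOrd t) (hf : IsRec G f s)
    (hg : IsRec G g t) {β : K} (hβs : β ∈ₘ s) (hβt : β ∈ₘ t) : ev f β = ev g β := by
  refine ord_induction (fun β => β ∈ₘ s → β ∈ₘ t → ev f β = ev g β) ?_ (isOrd_of_mem hs hβs)
    hβs hβt
  intro β _ ih hβs hβt
  rw [hf.2 β hβs, hg.2 β hβt]
  congr 1
  exact img_congr fun γ hγ => ih γ hγ (hs.1 β hβs γ hγ) (ht.1 β hβt γ hγ)

theorem ordRec_unique {G : K → K} (α y z : K) (hy : IsOrd α ∧ ∃ f, IsRec G f (succ α) ∧ y = ev f α)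
    (hz : IsOrd α ∧ ∃ f, IsRec G f (succ α) ∧ z = ev f α) : y = z := by
  obtain ⟨hα, f, hf, rfl⟩ := hy
  obtain ⟨-, g, hg, rfl⟩ := hz
  exact hf.unique (isOrd_succ hα) (isOrd_succ hα) hg (self_mem_succ α) (self_mem_succ α)

theorem IsRec.ev_eq_ordRec {G : K → K} {f s : K} (hs : IsOrd s) (hf : IsRec G f s) {β g : K} (hβ : β ∈ₘ s)
    (hg : IsRec G g (succ β)) : ev f β = ordRec G β := by
  have hβ' := isOrd_of_mem hs hβ
  rw [ordRec, the_eq (ordRec_unique β) ⟨hβ', g, hg, rfl⟩]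
  exact hf.unique hs (isOrd_succ hβ') hg hβ (self_mem_succ β)

section

variable {G : K → K} [hG : DMap K G]

instance Dfn.isRec {f s : X → K} [DMap K f] [DMap K s] :
    Dfn K (no_index (fun x => IsRec G (f x) (s x))) := by
  have := @hG.pull
  refine Dfn.comp₂ (R := IsRec G) ?_ f s
  unfold IsRec
  infer_instance

instance dmap_ordRec {f : X → K} [hf : DMap K f] : DMap K (no_index (fun x => ordRec G (f x))) :=
  (dmap_the (X := K) (P := fun α y => IsOrd α ∧ ∃ f, IsRec G f (succ α) ∧ y = ev f α)
    ordRec_unique).pull f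

/-- By induction `ordRec G` already obeys the recursion below `α`. One more application of `G` to
its values then gives a solution on `succ α`. -/
theorem exists_isRec {α : K} (hα : IsOrd α) : ∃ f, IsRec G f (succ α) := by
  refine ord_induction (fun α => ∃ f, IsRec G f (succ α)) (fun α hα ih => ?_) hα
  have := @hG.pull
  have key : ∀ γ, γ ∈ₘ α → ordRec G γ = G (img γ fun δ => ordRec G δ) := by
    intro γ hγ
    have hγ' := isOrd_of_mem hα hγ
    obtain ⟨f, hf⟩ := ih γ hγ
    rw [← hf.ev_eq_ordRec (isOrd_succ hγ') (self_mem_succ γ) hf, hf.2 γ (self_mem_succ γ)]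
    congr 1
    refine img_congr fun δ hδ => ?_
    obtain ⟨g, hg⟩ := ih δ (hα.1 γ hγ δ hδ)
    exact hf.ev_eq_ordRec (isOrd_succ hγ') (mem_succ.2 (Or.inl hδ)) hg
  refine ⟨lam (succ α) fun β => G (img β fun γ => ordRec G γ), isFunOn_lam _ _, fun β hβ => ?_⟩
  rw [ev_lam hβ]
  congr 1
  refine img_congr fun γ hγ => ?_
  have hγα : γ ∈ₘ α := by
    rcases mem_succ.1 hβ with hβ | rfl
    · exact hα.1 β hβ γ hγ
    · exact hγ
  rw [ev_lam (mem_succ.2 (Or.inl hγα)), key γ hγα]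

theorem ordRec_eq {α : K} (hα : IsOrd α) : ordRec G α = G (img α fun γ => ordRec G γ) := by
  obtain ⟨f, hf⟩ := exists_isRec (G := G) hα
  rw [← hf.ev_eq_ordRec (isOrd_succ hα) (self_mem_succ α) hf, hf.2 α (self_mem_succ α)]
  congr 1
  refine img_congr fun γ hγ => ?_
  obtain ⟨g, hg⟩ := exists_isRec (G := G) (isOrd_of_mem hα hγ)
  exact hf.ev_eq_ordRec (isOrd_succ hα) (mem_succ.2 (Or.inl hγ)) hg

end

/-! ### The cumulative hierarchy and ranks -/

/-- the `α`-th level of the cumulative hierarchy -/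
noncomputable def vLevel (α : K) : K := ordRec (fun S => sUnion (img S fun z => pow z)) α

instance dmap_vLevel {f : X → K} [hf : DMap K f] : DMap K (no_index (fun x => vLevel (f x))) := by
  unfold vLevel; infer_instance

theorem mem_vLevel {α x : K} (hα : IsOrd α) :
    x ∈ₘ vLevel α ↔ ∃ γ, γ ∈ₘ α ∧ Sub x (vLevel γ) := by
  rw [vLevel, ordRec_eq hα]
  rw [mem_sUnion]
  constructor
  · rintro ⟨z, hz, hx⟩
    obtain ⟨w, hw, rfl⟩ := mem_img.1 hz
    obtain ⟨γ, hγ, rfl⟩ := mem_img.1 hw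
    exact ⟨γ, hγ, mem_pow.1 hx⟩
  · rintro ⟨γ, hγ, hx⟩
    exact ⟨_, mem_img.2 ⟨_, mem_img.2 ⟨γ, hγ, rfl⟩, rfl⟩, mem_pow.2 hx⟩

/-- Any function witnessing `IsV` agrees with `vLevel` by induction on ordinals, and `vLevel`
restricted to `succ α` is itself such a function. -/
theorem isV_iff {v α : K} : IsV v α ↔ IsOrd α ∧ v = vLevel α := by
  constructor
  · rintro ⟨hα, s, f, hs, hf, hrec, hv⟩
    rw [isSucc_iff] at hs
    subst hs
    have hαs := self_mem_succ α
    refine ⟨hα, ((hf.app_iff hαs).1 hv).trans ?_⟩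
    refine ord_induction (fun β => β ∈ₘ succ α → ev f β = vLevel β) (fun β hβ ih hβs => ?_) hα hαs
    refine ext_mem fun x => ?_
    rw [hrec β (ev f β) hβs ((hf.app_iff hβs).2 rfl), mem_vLevel hβ]
    refine exists_congr fun γ => ?_
    constructor
    · rintro ⟨z, hγ, hz, hx⟩
      have hγs := (isOrd_succ hα).1 β hβs γ hγ
      rw [hf.app_iff hγs, ih γ hγ hγs] at hz
      exact ⟨hγ, hz ▸ hx⟩
    · rintro ⟨hγ, hx⟩
      have hγs := (isOrd_succ hα).1 β hβs γ hγ
      exact ⟨_, hγ, (hf.app_iff hγs).2 (ih γ hγ hγs).symm, hx⟩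
  · rintro ⟨hα, rfl⟩
    refine ⟨hα, succ α, lam (succ α) fun β => vLevel β, isSucc_iff.2 rfl, isFunOn_lam _ _,
      fun β y hβ hy x => ?_, app_lam.2 ⟨self_mem_succ α, rfl⟩⟩
    obtain ⟨-, rfl⟩ := app_lam.1 hy
    rw [mem_vLevel (isOrd_of_mem (isOrd_succ hα) hβ)]
    refine exists_congr fun γ => ?_
    constructor
    · rintro ⟨hγ, hx⟩
      exact ⟨_, hγ, app_lam.2 ⟨(isOrd_succ hα).1 β hβ γ hγ, rfl⟩, hx⟩
    · rintro ⟨z, hγ, hz, hx⟩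
      obtain ⟨-, rfl⟩ := app_lam.1 hz
      exact ⟨hγ, hx⟩

theorem vLevel_mono {α β : K} (hβ : IsOrd β) (h : α ∈ₘ β) : Sub (vLevel α) (vLevel β) := by
  intro x hx
  obtain ⟨γ, hγ, hx⟩ := (mem_vLevel (isOrd_of_mem hβ h)).1 hx
  exact (mem_vLevel hβ).2 ⟨γ, hβ.1 α h γ hγ, hx⟩

theorem isTrans_vLevel {α : K} (hα : IsOrd α) : IsTrans (vLevel α) := by
  intro x hx z hz
  obtain ⟨γ, hγ, hx⟩ := (mem_vLevel hα).1 hx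
  exact vLevel_mono hα hγ z (hx z hz)

theorem sub_vLevel_self {α : K} (hα : IsOrd α) : Sub α (vLevel α) :=
  ord_induction (fun α => Sub α (vLevel α))
    (fun _ hα ih β hβ => (mem_vLevel hα).2 ⟨β, hβ, ih β hβ⟩) hα

theorem exists_least_ord (P : K → Prop) [Dfn K P] {α : K} (hα : IsOrd α) (h : P α) :
    ∃ β, IsOrd β ∧ P β ∧ ∀ γ, γ ∈ₘ β → ¬ P γ := by
  obtain ⟨β, hβ, hP, hmin⟩ := exists_minimal P (self_mem_succ α) h
  have hs := isOrd_succ hα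
  exact ⟨β, isOrd_of_mem hs hβ, hP, fun γ hγ => hmin γ (hs.1 β hβ γ hγ) hγ⟩

theorem least_ord_unique (P : K → Prop) (α β : K) (hα : IsOrd α ∧ P α ∧ ∀ γ, γ ∈ₘ α → ¬ P γ)
    (hβ : IsOrd β ∧ P β ∧ ∀ γ, γ ∈ₘ β → ¬ P γ) : α = β := by
  rcases ord_trichotomy hα.1 hβ.1 with h | h | h
  · exact absurd hα.2.1 (hβ.2.2 α h)
  · exact h
  · exact absurd hβ.2.1 (hα.2.2 β h)

/-- the least ordinal with `P` -/
noncomputable def leastOrd (P : K → Prop) : K :=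
  the fun α => IsOrd α ∧ P α ∧ ∀ γ, γ ∈ₘ α → ¬ P γ

instance dmap_leastOrd {P : X → K → Prop} [hP : Dfn K (fun p : X × K => P p.1 p.2)] :
    DMap K (no_index (fun x => leastOrd (P x))) := by
  have := @hP.pull₂
  exact dmap_the (P := fun x α => IsOrd α ∧ P x α ∧ ∀ γ, γ ∈ₘ α → ¬ P x γ)
    fun x => least_ord_unique (P x)

theorem leastOrd_spec (P : K → Prop) [Dfn K P] {α : K} (hα : IsOrd α) (h : P α) :
    IsOrd (leastOrd P) ∧ P (leastOrd P) ∧ ∀ γ, γ ∈ₘ leastOrd P → ¬ P γ := by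
  obtain ⟨β, hβ⟩ := exists_least_ord P hα h
  rwa [leastOrd, the_eq (least_ord_unique P) hβ]

/-- Each stage collects `x`, the earlier stages and the elements of their elements. An element of an
element of stage `n` thus appears at stage `succ n`, and the union over `ω` is transitive. -/
theorem exists_transitive_superset (x : K) : ∃ t, IsTrans t ∧ Sub x t := by
  let G : K → K := fun S => union x (union (sUnion S) (sUnion (sUnion S)))
  have hG : DMap K G := by simp only [G]; infer_instance
  have mem_G : ∀ S z, z ∈ₘ G S ↔ z ∈ₘ x ∨ z ∈ₘ sUnion S ∨ z ∈ₘ sUnion (sUnion S) := fun S z => by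
    simp only [G, mem_union]
  clear_value G
  have mem : ∀ {n : K}, n ∈ₘ omega K → ∀ z, z ∈ₘ ordRec G n ↔ z ∈ₘ x ∨
      (∃ m, m ∈ₘ n ∧ z ∈ₘ ordRec G m) ∨ ∃ m, m ∈ₘ n ∧ ∃ y, y ∈ₘ ordRec G m ∧ z ∈ₘ y := by
    intro n hn z
    rw [ordRec_eq (isOrd_of_mem isOrd_omega hn)]
    have hS : ∀ y, y ∈ₘ sUnion (img n fun m => ordRec G m) ↔ ∃ m, m ∈ₘ n ∧ y ∈ₘ ordRec G m := by
      intro y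
      rw [mem_sUnion]
      constructor
      · rintro ⟨w, hw, hy⟩
        obtain ⟨m, hm, rfl⟩ := mem_img.1 hw
        exact ⟨m, hm, hy⟩
      · rintro ⟨m, hm, hy⟩
        exact ⟨_, mem_img.2 ⟨m, hm, rfl⟩, hy⟩
    rw [mem_G, hS, mem_sUnion]
    simp only [hS]
    refine or_congr_right (or_congr_right ⟨?_, ?_⟩)
    · rintro ⟨y, ⟨m, hm, hy⟩, hz⟩
      exact ⟨m, hm, y, hy, hz⟩
    · rintro ⟨m, hm, y, hy, hz⟩
      exact ⟨y, ⟨m, hm, hy⟩, hz⟩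
  refine ⟨sUnion (img (omega K) fun n => ordRec G n), fun y hy z hz => ?_, fun y hy => ?_⟩
  · simp only [mem_sUnion, mem_img] at hy ⊢
    obtain ⟨_, ⟨n, hn, rfl⟩, hy⟩ := hy
    exact ⟨_, ⟨succ n, succ_mem_omega hn, rfl⟩,
      (mem (succ_mem_omega hn) z).2 (Or.inr (Or.inr ⟨n, self_mem_succ n, y, hy, hz⟩))⟩
  · simp only [mem_sUnion, mem_img]
    exact ⟨_, ⟨_, emptySet_mem_omega, rfl⟩, (mem emptySet_mem_omega y).2 (Or.inl hy)⟩

theorem isOrd_sUnion {a : K} (h : ∀ α, α ∈ₘ a → IsOrd α) : IsOrd (sUnion a) := by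
  constructor
  · intro y hy z hz
    obtain ⟨α, hα, hy⟩ := mem_sUnion.1 hy
    exact mem_sUnion.2 ⟨α, hα, (h α hα).1 y hy z hz⟩
  · intro y hy
    obtain ⟨α, hα, hy⟩ := mem_sUnion.1 hy
    exact (h α hα).2 y hy

theorem exists_sub_vLevel (x : K) : ∃ α, IsOrd α ∧ Sub x (vLevel α) := by
  have step : ∀ x : K, (∀ y, y ∈ₘ x → ∃ α, IsOrd α ∧ Sub y (vLevel α)) →
      ∃ α, IsOrd α ∧ Sub x (vLevel α) := by
    intro x hx
    have hr : ∀ y, y ∈ₘ x → IsOrd (leastOrd fun α => Sub y (vLevel α)) ∧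
        Sub y (vLevel (leastOrd fun α => Sub y (vLevel α))) := by
      intro y hy
      obtain ⟨α, hα, h⟩ := hx y hy
      have := leastOrd_spec (fun α => Sub y (vLevel α)) hα h
      exact ⟨this.1, this.2.1⟩
    -- The witness is the supremum of the successors of the ranks of the elements.
    have hord : IsOrd (sUnion (img x fun y => succ (leastOrd fun α => Sub y (vLevel α)))) := by
      refine isOrd_sUnion fun α hα => ?_
      obtain ⟨y, hy, rfl⟩ := mem_img.1 hα
      exact isOrd_succ (hr y hy).1
    refine ⟨_, hord, fun y hy => (mem_vLevel hord).2 ⟨_, mem_sUnion.2 ⟨_, mem_img.2 ⟨y, hy, rfl⟩,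
      self_mem_succ _⟩, (hr y hy).2⟩⟩
  refine step x fun y hy => ?_
  by_contra hcon
  -- Foundation is available only inside a set; transitivity of `t` keeps the elements of a minimal
  -- counterexample within reach.
  obtain ⟨t, ht, hxt⟩ := exists_transitive_superset x
  obtain ⟨z, hz, hz', hmin⟩ := exists_minimal (fun y => ¬ ∃ α, IsOrd α ∧ Sub y (vLevel α))
    (hxt y hy) hcon
  exact hz' (step z fun w hw => not_not.1 (hmin w (ht z hz w hw) hw))

theorem isRank_iff {x α : K} : IsRank x α ↔
    IsOrd α ∧ Sub x (vLevel α) ∧ ∀ γ, γ ∈ₘ α → ¬ Sub x (vLevel γ) := by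
  simp only [IsRank, isV_iff]
  constructor
  · rintro ⟨⟨v, ⟨hα, rfl⟩, hx⟩, h⟩
    exact ⟨hα, hx, fun γ hγ => h γ _ hγ ⟨isOrd_of_mem hα hγ, rfl⟩⟩
  · rintro ⟨hα, hx, h⟩
    refine ⟨⟨_, ⟨hα, rfl⟩, hx⟩, ?_⟩
    rintro β v hβ ⟨-, rfl⟩
    exact h β hβ

theorem rankLE_of_forall {x y : K} (h : ∀ α, IsOrd α → Sub y (vLevel α) → Sub x (vLevel α)) :
    RankLE x y := by
  obtain ⟨α, hα, hx⟩ := exists_sub_vLevel x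
  obtain ⟨β, hβ, hy⟩ := exists_sub_vLevel y
  obtain ⟨α, hα⟩ := exists_least_ord (fun α => Sub x (vLevel α)) hα hx
  obtain ⟨β, hβ⟩ := exists_least_ord (fun α => Sub y (vLevel α)) hβ hy
  refine ⟨α, β, isRank_iff.2 hα, isRank_iff.2 hβ, ?_⟩
  rcases ord_trichotomy hα.1 hβ.1 with h' | h' | h'
  · exact Or.inl h'
  · exact Or.inr h'
  · exact absurd (h β hβ.1 hβ.2.1) (hα.2.2 β h')

theorem rankLE_of_sub {x y : K} (h : Sub x y) : RankLE x y :=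
  rankLE_of_forall fun _ _ hy z hz => hy z (h z hz)

theorem rankLE_of_mem {x y : K} (h : x ∈ₘ y) : RankLE x y :=
  rankLE_of_forall fun _ hα hy z hz => isTrans_vLevel hα x (hy x h) z hz

/-- The Collection scheme. -/
theorem collection (R : K → K → Prop) [hR : Dfn K (fun p : K × K => R p.1 p.2)] (a : K) :
    ∃ b, ∀ x, x ∈ₘ a → (∃ y, R x y) → ∃ y, y ∈ₘ b ∧ R x y := by
  have := @hR.pull₂
  -- Scott's trick: for each `x`, take the first level of the hierarchy that contains a witness.
  refine ⟨sUnion (img a fun x => vLevel (leastOrd fun α => ∃ y, y ∈ₘ vLevel α ∧ R x y)), ?_⟩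
  rintro x hx ⟨y, hy⟩
  -- The singleton is used because inclusion of `{y}` in a level means that `y` is an element of it.
  obtain ⟨α, hα, hyα⟩ := exists_sub_vLevel (upair y y)
  obtain ⟨-, ⟨z, hz, hz'⟩, -⟩ := leastOrd_spec (fun α => ∃ y, y ∈ₘ vLevel α ∧ R x y) hα
    ⟨y, hyα y (mem_upair.2 (Or.inl rfl)), hy⟩
  exact ⟨z, mem_sUnion.2 ⟨_, mem_img.2 ⟨x, hx, rfl⟩, hz⟩, hz'⟩

end Recursion

/-- `K` is a model of `ZFC`. -/
class ZFCModel (K : Type u) [LSet.Structure K] : Prop extends ZFModel K where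
  choice : ∀ x : K, ((∀ y, y ∈ₘ x → ∃ z, z ∈ₘ y) ∧
      ∀ y, y ∈ₘ x → ∀ z, z ∈ₘ x → (∃ w, w ∈ₘ y ∧ w ∈ₘ z) → y = z) →
      ∃ c, ∀ y, y ∈ₘ x → ∃ w, ∀ v, v ∈ₘ y ∧ v ∈ₘ c ↔ v = w

theorem zfcModel_of_model {K : Type u} [LSet.Structure K] (h : K ⊨ ZFC memSym) : ZFCModel K where
  toZFModel := zfModel_of_model (h.mono Set.subset_union_left)
  choice := (realize_axChoice memSym).1 (h.realize_of_mem _ (Or.inr rfl))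

/-- Collection bounds the witnesses by a set `b`, after which the transversal form of choice applies
to a disjoint family. -/
theorem exists_choice_function {K : Type u} [LSet.Structure K] [hK : ZFCModel K]
    (R : K → K → Prop) [hR : Dfn K (fun p : K × K => R p.1 p.2)] (a : K) :
    ∃ f, IsFunOn f a ∧ ∀ x, x ∈ₘ a → (∃ y, R x y) → R x (ev f x) := by
  have := @hR.pull₂
  obtain ⟨b, hb⟩ := collection R a
  -- Tagging each witness with `x` makes the sets `S x` pairwise disjoint.
  let S : K → K := fun x => img (sep b fun y => R x y) fun y => opair x y
  have hS : DMap K S := by simp only [S]; infer_instance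
  have mem_S : ∀ {x p}, p ∈ₘ S x ↔ ∃ y, (y ∈ₘ b ∧ R x y) ∧ p = opair x y := by
    intro x p
    simp only [S, mem_img]
    exact exists_congr fun y => and_congr_left fun _ => mem_sep
  obtain ⟨c, hc⟩ := hK.choice (img (sep a fun x => ∃ y, y ∈ₘ b ∧ R x y) S) (by
    simp only [mem_img]
    constructor
    · rintro _ ⟨x, hx, rfl⟩
      obtain ⟨y, hy⟩ := (mem_sep.1 hx).2
      exact ⟨_, mem_S.2 ⟨y, hy, rfl⟩⟩
    · rintro _ ⟨x, -, rfl⟩ _ ⟨x', -, rfl⟩ ⟨w, hw, hw'⟩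
      obtain ⟨y, -, rfl⟩ := mem_S.1 hw
      obtain ⟨y', -, h⟩ := mem_S.1 hw'
      rw [(opair_inj.1 h).1])
  refine ⟨lam a fun x => sUnion (sep b fun y => R x y ∧ opair x y ∈ₘ c), isFunOn_lam _ _,
    fun x hx hxy => ?_⟩
  rw [ev_lam hx]
  obtain ⟨w, hw⟩ := hc (S x) (mem_img.2 ⟨x, mem_sep.2 ⟨hx, hb x hx hxy⟩, rfl⟩)
  obtain ⟨hw1, hw2⟩ := (hw w).2 rfl
  obtain ⟨y, ⟨hy, hRy⟩, rfl⟩ := mem_S.1 hw1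
  have : sUnion (sep b fun y => R x y ∧ opair x y ∈ₘ c) = y := by
    refine ext_mem fun z => ?_
    rw [mem_sUnion]
    constructor
    · rintro ⟨y', hy', hz⟩
      obtain ⟨h1, h2, h3⟩ := mem_sep.1 hy'
      have := (hw (opair x y')).1 ⟨mem_S.2 ⟨y', ⟨h1, h2⟩, rfl⟩, h3⟩
      rwa [← (opair_inj.1 this).2]
    · exact fun hz => ⟨y, mem_sep.2 ⟨hy, hRy, hw2⟩, hz⟩
  rwa [this]

/-! ### Łoś's theorem for the internal ultrapower -/

section Los

variable {K : Type u} [LSet.Structure K] {X : Type u} [Ctx K X]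

section Ultrafilter

variable [hK : ZFModel K]

/-- `{n ∈ ω : P n}` is an element of `U`. -/
def InU (U : K) (P : K → Prop) : Prop := ∃ S, S ∈ₘ U ∧ ∀ n, n ∈ₘ S ↔ n ∈ₘ omega K ∧ P n

instance Dfn.inU {U : K} {P : X → K → Prop} [hP : Dfn K (fun p : X × K => P p.1 p.2)] :
    Dfn K (no_index (fun x => InU U (P x))) := by
  have := @hP.pull₂
  unfold InU
  infer_instance

variable {U : K}

theorem InU.congr {P Q : K → Prop} (h : InU U P) (hPQ : ∀ n, n ∈ₘ omega K → (P n ↔ Q n)) :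
    InU U Q := by
  obtain ⟨S, hS, hS'⟩ := h
  exact ⟨S, hS, fun n => (hS' n).trans (and_congr_right (hPQ n))⟩

theorem inU_congr {P Q : K → Prop} (hPQ : ∀ n, n ∈ₘ omega K → (P n ↔ Q n)) : InU U P ↔ InU U Q :=
  ⟨fun h => h.congr hPQ, fun h => h.congr fun n hn => (hPQ n hn).symm⟩

theorem InU.mono (hU : IsNonprincipalUltrafilter U) {P Q : K → Prop} [Dfn K Q] (h : InU U P)
    (hPQ : ∀ n, n ∈ₘ omega K → P n → Q n) : InU U Q := by
  obtain ⟨w, hw, -, -, -, h5, -⟩ := hU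
  rw [isOmega_iff] at hw
  subst hw
  obtain ⟨S, hS, hS'⟩ := h
  refine ⟨sep (omega K) Q, h5 S _ hS (fun n hn => ?_) (fun n hn => (mem_sep.1 hn).1),
    fun n => mem_sep⟩
  obtain ⟨h1, h2⟩ := (hS' n).1 hn
  exact mem_sep.2 ⟨h1, hPQ n h1 h2⟩

theorem inU_of_forall (hU : IsNonprincipalUltrafilter U) {P : K → Prop}
    (h : ∀ n, n ∈ₘ omega K → P n) : InU U P := by
  obtain ⟨w, hw, -, h3, -⟩ := hU
  rw [isOmega_iff] at hw
  subst hw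
  exact ⟨omega K, h3, fun n => ⟨fun hn => ⟨hn, h n hn⟩, And.left⟩⟩

theorem InU.nonempty (hU : IsNonprincipalUltrafilter U) {P : K → Prop} (h : InU U P) :
    ∃ n, n ∈ₘ omega K ∧ P n := by
  obtain ⟨w, -, -, -, h4, -⟩ := hU
  obtain ⟨S, hS, hS'⟩ := h
  by_contra hcon
  exact h4 S (fun n hn => hcon ⟨n, (hS' n).1 hn⟩) hS

theorem InU.and (hU : IsNonprincipalUltrafilter U) {P Q : K → Prop} [Dfn K P] [Dfn K Q]
    (hP : InU U P) (hQ : InU U Q) : InU U fun n => P n ∧ Q n := by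
  obtain ⟨w, -, -, -, -, -, h6, -⟩ := hU
  obtain ⟨S, hS, hS'⟩ := hP
  obtain ⟨T, hT, hT'⟩ := hQ
  have mem : ∀ n, n ∈ₘ sep (omega K) (fun n => P n ∧ Q n) ↔ n ∈ₘ omega K ∧ P n ∧ Q n :=
    fun n => mem_sep
  refine ⟨_, h6 S T (sep (omega K) fun n => P n ∧ Q n) hS hT fun n => ?_, mem⟩
  rw [mem, hS', hT']
  tauto

theorem inU_not (hU : IsNonprincipalUltrafilter U) {P : K → Prop} [Dfn K P] :
    InU U (fun n => ¬ P n) ↔ ¬ InU U P := by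
  refine ⟨fun h h' => ?_, fun h => ?_⟩
  · obtain ⟨n, -, hn, hn'⟩ := (h.and hU h').nonempty hU
    exact hn hn'
  · obtain ⟨w, hw, -, -, -, -, -, h7, -⟩ := hU
    rw [isOmega_iff] at hw
    subst hw
    rcases h7 (sep (omega K) P) (sep (omega K) fun n => ¬ P n) (fun n hn => (mem_sep.1 hn).1)
      (fun n => by rw [mem_sep, mem_sep]; tauto) with h' | h'
    · exact absurd ⟨_, h', fun n => mem_sep⟩ h
    · exact ⟨_, h', fun n => mem_sep⟩

theorem inU_imp (hU : IsNonprincipalUltrafilter U) {P Q : K → Prop} [Dfn K P] [Dfn K Q] :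
    InU U (fun n => P n → Q n) ↔ (InU U P → InU U Q) := by
  refine ⟨fun h hP => (h.and hU hP).mono hU fun n _ h => h.1 h.2, fun h => ?_⟩
  by_cases hP : InU U P
  · exact (h hP).mono hU fun n _ hQ _ => hQ
  · exact ((inU_not hU).2 hP).mono hU fun n _ hn hn' => absurd hn' hn

theorem inU_const (hU : IsNonprincipalUltrafilter U) {p : Prop} : InU U (fun _ => p) ↔ p := by
  refine ⟨fun h => ?_, fun h => inU_of_forall hU fun _ _ => h⟩
  obtain ⟨n, -, hp⟩ := h.nonempty hU
  exact hp

/-- If `{m}` were in `U`, then `U` would consist exactly of the subsets of `ω` containing `m`,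
contrary to nonprincipality. -/
theorem inU_ne (hU : IsNonprincipalUltrafilter U) {m : K} (hm : m ∈ₘ omega K) :
    InU U fun n => n ≠ m := by
  refine (inU_not hU).2 fun h => ?_
  have hU' := hU
  obtain ⟨w, hw, h2, -, -, -, -, -, h8⟩ := hU
  rw [isOmega_iff] at hw
  subst hw
  refine h8 ⟨m, hm, fun S => ⟨fun hS => ⟨h2 S hS, ?_⟩, fun hS => ?_⟩⟩
  · have hS' : InU U fun n => n ∈ₘ S :=
      ⟨S, hS, fun n => ⟨fun hn => ⟨h2 S hS n hn, hn⟩, And.right⟩⟩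
    obtain ⟨n, -, hn, rfl⟩ := (hS'.and hU' h).nonempty hU'
    exact hn
  · obtain ⟨T, hT, hT'⟩ := h.mono hU' (Q := fun n => n ∈ₘ S) (by rintro n - rfl; exact hS.2)
    have : T = S := ext_mem fun n => (hT' n).trans ⟨And.right, fun hn => ⟨hS.1 n hn, hn⟩⟩
    rwa [← this]

theorem isOmegaSeq_iff {f : K} : IsOmegaSeq f ↔ IsFunOn f (omega K) := by
  simp [IsOmegaSeq, isOmega_iff]

theorem eqMod_iff {f g : K} (hf : IsOmegaSeq f) (hg : IsOmegaSeq g) :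
    EqMod U f g ↔ InU U fun n => ev f n = ev g n := by
  rw [isOmegaSeq_iff] at hf hg
  simp only [EqMod, isOmega_iff, exists_eq_left, exists_and_left, InU]
  refine exists_congr fun S => and_congr_right fun _ => forall_congr' fun n => ?_
  refine iff_congr Iff.rfl (and_congr_right fun hn => ?_)
  simp [hf.app_iff hn, hg.app_iff hn]

theorem memMod_iff {f g : K} (hf : IsOmegaSeq f) (hg : IsOmegaSeq g) :
    MemMod U f g ↔ InU U fun n => ev f n ∈ₘ ev g n := by
  rw [isOmegaSeq_iff] at hf hg
  simp only [MemMod, isOmega_iff, exists_eq_left, exists_and_left, InU]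
  refine exists_congr fun S => and_congr_right fun _ => forall_congr' fun n => ?_
  refine iff_congr Iff.rfl (and_congr_right fun hn => ?_)
  simp [hf.app_iff hn, hg.app_iff hn]

/-- The filter properties make `EqMod U` an equivalence relation, so the quotient identifies nothing
further. -/
theorem mk_eq_mk (hU : IsNonprincipalUltrafilter U) {f g : {f : K // IsOmegaSeq f}} :
    InternalUltrapower.mk U f = InternalUltrapower.mk U g ↔ InU U fun n => ev f.1 n = ev g.1 n := by
  have h : Equivalence fun f g : {f : K // IsOmegaSeq f} => EqMod U f.1 g.1 := by
    refine ⟨fun f => (eqMod_iff f.2 f.2).2 (inU_of_forall hU fun _ _ => rfl), fun {f g} h => ?_,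
      fun {f g k} h h' => ?_⟩
    · rw [eqMod_iff f.2 g.2] at h
      exact (eqMod_iff g.2 f.2).2 (h.congr fun _ _ => eq_comm)
    · rw [eqMod_iff f.2 g.2] at h
      rw [eqMod_iff g.2 k.2] at h'
      exact (eqMod_iff f.2 k.2).2 ((h.and hU h').mono hU fun n _ h => h.1.trans h.2)
  exact (h.quot_mk_eq_iff f g).trans (eqMod_iff f.2 g.2)

theorem mk_mem_mk (hU : IsNonprincipalUltrafilter U) {f g : {f : K // IsOmegaSeq f}} :
    InternalUltrapower.mk U f ∈ₘ InternalUltrapower.mk U g ↔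
      InU U fun n => ev f.1 n ∈ₘ ev g.1 n := by
  constructor
  · rintro ⟨f', g', hf, hg, h⟩
    have hf := (mk_eq_mk hU).1 hf
    have hg := (mk_eq_mk hU).1 hg
    rw [memMod_iff f'.2 g'.2] at h
    refine (hf.and hU (hg.and hU h)).mono hU ?_
    rintro n - ⟨h1, h2, h3⟩
    rwa [h1, h2]
  · exact fun h => ⟨f, g, rfl, rfl, (memMod_iff f.2 g.2).2 h⟩

end Ultrafilter

/-- The formula `IsOmega`. -/
def isOmegaFormula : LSet.BoundedFormula Empty 1 :=
  ((∃' (memF memSym (n := 2) 1 0 ⊓ ∀' ∼(memF memSym (n := 3) 2 1))) ⊓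
    ∀' (memF memSym (n := 2) 1 0 ⟹ ∃' (memF memSym (n := 3) 2 0 ⊓
      ∀' (memF memSym (n := 4) 3 2 ⇔ (memF memSym 3 1 ⊔ eqF LSet 3 1))))) ⊓
  ∀' (((∃' (memF memSym (n := 3) 2 1 ⊓ ∀' ∼(memF memSym (n := 4) 3 2))) ⊓
    ∀' (memF memSym (n := 3) 2 1 ⟹ ∃' (memF memSym (n := 4) 3 1 ⊓
      ∀' (memF memSym (n := 5) 4 3 ⇔ (memF memSym 4 2 ⊔ eqF LSet 4 2))))) ⟹
    ∀' (memF memSym (n := 3) 2 0 ⟹ memF memSym 2 1))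

theorem realize_isOmegaFormula {N : Type u} [LSet.Structure N] {v : Empty → N} {xs : Fin 1 → N} :
    isOmegaFormula.Realize v xs ↔ IsOmega (xs 0) := by
  simp only [isOmegaFormula, BoundedFormula.realize_all,
    BoundedFormula.realize_iff, BoundedFormula.realize_ex, BoundedFormula.realize_imp,
    BoundedFormula.realize_inf, BoundedFormula.realize_sup, BoundedFormula.realize_not,
    realize_memF, realize_eqF]
  rfl

theorem IsOmega.map {N : Type u} [LSet.Structure N] (j : K ↪ₑ[LSet] N) {w : K} (h : IsOmega w) :
    IsOmega (j w) := by
  have := j.map_boundedFormula isOmegaFormula (default : Empty → K) (fun _ => w)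
  rw [realize_isOmegaFormula, realize_isOmegaFormula] at this
  exact this.2 h

variable [hK : ZFCModel K] {U : K}

/-- Łoś's theorem. -/
theorem realize_mk_iff (hU : IsNonprincipalUltrafilter U) {α : Type*} {m : ℕ}
    (φ : LSet.BoundedFormula α m) (f : α → {f : K // IsOmegaSeq f})
    (g : Fin m → {f : K // IsOmegaSeq f}) :
    φ.Realize (fun a => InternalUltrapower.mk U (f a)) (fun i => InternalUltrapower.mk U (g i)) ↔
      InU U fun n => φ.Realize (fun a => ev (f a).1 n) (fun i => ev (g i).1 n) := by
  -- Definability of pointwise truth lets `K` form the sets of indices to which `U` is applied.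
  have dfn : ∀ {m : ℕ} (φ : LSet.BoundedFormula α m) (g : Fin m → {f : K // IsOmegaSeq f}),
      Dfn K fun n => φ.Realize (fun a => ev (f a).1 n) (fun i => ev (g i).1 n) := fun φ g =>
    Dfn.realize φ (fun a n => ev (f a).1 n) (fun i n => ev (g i).1 n) (fun a => inferInstance)
      (fun i => inferInstance)
  have term : ∀ {m : ℕ} (t : LSet.Term (α ⊕ Fin m)) (g : Fin m → {f : K // IsOmegaSeq f}),
      ∃ h : {f : K // IsOmegaSeq f},
        t.realize (Sum.elim (fun a => InternalUltrapower.mk U (f a))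
          (fun i => InternalUltrapower.mk U (g i))) = InternalUltrapower.mk U h ∧
        ∀ n, t.realize (Sum.elim (fun a => ev (f a).1 n) (fun i => ev (g i).1 n)) = ev h.1 n := by
    intro m t g
    cases t with
    | var a => rcases a with a | i
               · exact ⟨f a, rfl, fun _ => rfl⟩
               · exact ⟨g i, rfl, fun _ => rfl⟩
    | func F _ => exact F.elim
  induction φ with
  | falsum => exact (inU_const hU).symm
  | equal t₁ t₂ =>
    obtain ⟨h₁, h1, h1'⟩ := term t₁ g
    obtain ⟨h₂, h2, h2'⟩ := term t₂ g
    simp only [BoundedFormula.Realize, h1, h2, h1', h2']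
    exact mk_eq_mk hU
  | rel R ts =>
    cases R
    obtain ⟨h₁, h1, h1'⟩ := term (ts 0) g
    obtain ⟨h₂, h2, h2'⟩ := term (ts 1) g
    have key : ∀ {N : Type u} [LSet.Structure N] (v : α → N) (xs : Fin _ → N),
        BoundedFormula.Realize (BoundedFormula.rel memSym ts) v xs ↔
          (ts 0).realize (Sum.elim v xs) ∈ₘ (ts 1).realize (Sum.elim v xs) := by
      intro N _ v xs
      refine iff_of_eq (congrArg (Structure.RelMap memSym) (funext fun i => ?_))
      fin_cases i <;> rfl
    refine (key _ _).trans ?_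
    rw [h1, h2, mk_mem_mk hU]
    exact inU_congr fun n _ => by rw [← h1', ← h2']; exact (key _ _).symm
  | imp φ ψ hφ hψ =>
    have := dfn φ g
    have := dfn ψ g
    simp only [BoundedFormula.realize_imp, hφ, hψ]
    exact (inU_imp hU).symm
  | @all m φ hφ =>
    have snoc_mk : ∀ h : {f : K // IsOmegaSeq f},
        (Fin.snoc (α := fun _ => InternalUltrapower U) (fun i => InternalUltrapower.mk U (g i))
          (InternalUltrapower.mk U h) : Fin (m + 1) → _) =
        fun i => InternalUltrapower.mk U
          (Fin.snoc (α := fun _ => {f : K // IsOmegaSeq f}) g h i) := by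
      intro h
      funext i
      induction i using Fin.lastCases with
      | last => simp
      | cast i => simp
    have snoc_ev : ∀ (h : {f : K // IsOmegaSeq f}) (n : K),
        (Fin.snoc (α := fun _ => K) (fun i => ev (g i).1 n) (ev h.1 n) : Fin (m + 1) → K) =
        fun i => ev (Fin.snoc (α := fun _ => {f : K // IsOmegaSeq f}) g h i).1 n := by
      intro h n
      funext i
      induction i using Fin.lastCases with
      | last => simp
      | cast i => simp
    let R : K → K → Prop := fun n y => φ.Realize (fun a => ev (f a).1 n)
      (Fin.snoc (α := fun _ => K) (fun i => ev (g i).1 n) y)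
    have hR : Dfn K fun p : K × K => R p.1 p.2 :=
      Dfn.realize (K := K) (X := K × K) φ (fun a p => ev (f a).1 p.1)
        (fun i p => Fin.snoc (α := fun _ => K) (fun i => ev (g i).1 p.1) p.2 i)
        (fun a => inferInstance) (fun i => by
          induction i using Fin.lastCases with
          | last => simp only [Fin.snoc_last]; infer_instance
          | cast i => simp only [Fin.snoc_castSucc]; infer_instance)
    have hR' := @hR.pull₂
    have step : ∀ h : {f : K // IsOmegaSeq f},
        φ.Realize (fun a => InternalUltrapower.mk U (f a))
          (Fin.snoc (α := fun _ => InternalUltrapower U) (fun i => InternalUltrapower.mk U (g i))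
            (InternalUltrapower.mk U h)) ↔ InU U fun n => R n (ev h.1 n) := by
      intro h
      exact (iff_of_eq (congrArg (φ.Realize _) (snoc_mk h))).trans ((hφ _).trans
        (inU_congr fun n _ => iff_of_eq (congrArg (φ.Realize _) (snoc_ev h n).symm)))
    change (∀ x, _) ↔ InU U fun n => ∀ y, R n y
    constructor
    · intro hall
      -- Let `h` select a counterexample at every index that has one. Truth at the class of `h` then
      -- means that almost no index has a counterexample.
      obtain ⟨h, hh, hh'⟩ := exists_choice_function (fun n y => ¬ R n y) (omega K)
      have := (step ⟨h, isOmegaSeq_iff.2 hh⟩).1 (hall _)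
      refine this.mono hU fun n hn hRn y => ?_
      by_contra hy
      exact hh' n hn ⟨y, hy⟩ hRn
    · rintro h ⟨k⟩
      exact (step k).2 (h.mono hU fun n _ hn => hn _)

theorem formula_realize_mk_iff (hU : IsNonprincipalUltrafilter U) {α : Type*}
    (φ : LSet.Formula α) (f : α → {f : K // IsOmegaSeq f}) :
    φ.Realize (fun a => InternalUltrapower.mk U (f a)) ↔
      InU U fun n => φ.Realize (fun a => ev (f a).1 n) := by
  refine Iff.trans (iff_of_eq ?_) ((realize_mk_iff hU φ f Fin.elim0).trans
    (inU_congr fun n _ => iff_of_eq ?_))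
  · exact congrArg (BoundedFormula.Realize φ _) (Subsingleton.elim _ _)
  · exact congrArg (BoundedFormula.Realize φ _) (Subsingleton.elim _ _)

/-- The function on `ω` with constant value `k`. -/
noncomputable def constSeq (k : K) : {f : K // IsOmegaSeq f} :=
  ⟨lam (omega K) fun _ => k, isOmegaSeq_iff.2 (isFunOn_lam _ _)⟩

theorem ev_constSeq {k n : K} (hn : n ∈ₘ omega K) : ev (constSeq k).1 n = k := ev_lam hn

theorem isConstSeq_constSeq (k : K) : IsConstSeq (constSeq k).1 k := by
  refine ⟨omega K, isOmega_omega, fun p => ?_⟩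
  simp only [constSeq, lam, mem_img, isOPair_iff]

/-- The embedding of `K` into its internal ultrapower by constant functions. -/
noncomputable def ultrapowerEmbedding (hU : IsNonprincipalUltrafilter U) :
    K ↪ₑ[LSet] InternalUltrapower U where
  toFun k := InternalUltrapower.mk U (constSeq k)
  map_formula' := by
    intro m φ x
    -- Truth in `K` does not depend on the index, so it can be read as truth at `U`-almost every
    -- index.
    rw [← inU_const hU (p := φ.Realize x)]
    refine (formula_realize_mk_iff hU φ (fun i => constSeq (x i))).trans (inU_congr fun n hn => ?_)
    simp only [ev_constSeq hn]

/-- Fixed representatives of the parameters are elements of `K`. By Łoś, `j(k) ∈ D` says that the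
defining formula holds of their values and `k` at almost every index, which `K` can express. -/
theorem conservative_ultrapowerEmbedding (hU : IsNonprincipalUltrafilter U) :
    Conservative (ultrapowerEmbedding hU).toEmbedding.toEmbedding := by
  intro D hD
  obtain ⟨φ, hφ⟩ := exists_formula_of_definable₁ hD
  let rep : InternalUltrapower U → {f : K // IsOmegaSeq f} := Quot.out
  have hrep : ∀ m, InternalUltrapower.mk U (rep m) = m := Quot.out_eq
  let F : InternalUltrapower U ⊕ Fin 1 → K × K → K :=
    Sum.elim (fun m p => ev (rep m).1 p.2) (fun _ p => p.1)
  have hF : Dfn K fun p : K × K => φ.Realize fun a => F a p := by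
    refine Dfn.realize_formula φ F ?_
    rintro (m | i) <;> (simp only [F, Sum.elim_inl, Sum.elim_inr]; infer_instance)
  have hF' := @Dfn.pull₂ K _ K K _ _ (fun k n => φ.Realize fun a => F a (k, n)) hF
  have key : ∀ k, ultrapowerEmbedding hU k ∈ D ↔
      InU U fun n => φ.Realize fun a => F a (k, n) := by
    intro k
    rw [hφ]
    have h := formula_realize_mk_iff hU φ (Sum.elim rep fun _ => constSeq k)
    refine Iff.trans (iff_of_eq (congrArg _ (funext fun a => ?_)))
      (h.trans (inU_congr fun n hn => iff_of_eq (congrArg _ (funext fun a => ?_))))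
    · rcases a with m | i
      · exact (hrep m).symm
      · rfl
    · rcases a with m | i
      · rfl
      · exact ev_constSeq hn
  have hD' : Dfn K fun k => ultrapowerEmbedding hU k ∈ D :=
    Dfn.congr (P := fun k => InU U fun n => φ.Realize fun a => F a (k, n)) inferInstance key
  exact hD'.definable₁

/-- Induction inside `K` shows that `U`-almost every `k` avoids a given natural number `m`, as
adding one point to `m` excludes one more index. Trichotomy with `m = succ n` leaves `n ∈ k`. -/
theorem inU_mem (hU : IsNonprincipalUltrafilter U) {n : K} (hn : n ∈ₘ omega K) :
    InU U fun k => n ∈ₘ k := by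
  have h : ∀ m, m ∈ₘ omega K → InU U fun k => ¬ k ∈ₘ m := fun m hm =>
    omega_induction (fun m => InU U fun k => ¬ k ∈ₘ m)
      (inU_of_forall hU fun k _ => not_mem_emptySet k)
      (fun m hm ih => (ih.and hU (inU_ne hU hm)).mono hU fun k _ h hk =>
        (mem_succ.1 hk).elim h.1 h.2) hm
  refine (h _ (succ_mem_omega hn)).mono hU fun k hk hkn => ?_
  rcases ord_trichotomy (isOrd_of_mem isOrd_omega hn) (isOrd_of_mem isOrd_omega hk) with h | h | h
  · exact h
  · exact absurd (mem_succ.2 (Or.inr h.symm)) hkn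
  · exact absurd (mem_succ.2 (Or.inl h)) hkn

theorem zfModel_ultrapower (hK : K ⊨ ZF memSym) (hU : IsNonprincipalUltrafilter U) :
    InternalUltrapower U ⊨ ZF memSym :=
  ((ultrapowerEmbedding hU).theory_model_iff _).1 hK

theorem not_omegaStandard_ultrapower [hM : ZFModel (InternalUltrapower U)]
    (hstd : OmegaStandard K) (hU : IsNonprincipalUltrafilter U) :
    ¬ OmegaStandard (InternalUltrapower U) := by
  rintro ⟨w, hw, ⟨e⟩⟩
  obtain ⟨w', hw', ⟨e'⟩⟩ := hstd
  rw [isOmega_iff] at hw hw'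
  subst hw' hw
  let j := ultrapowerEmbedding hU
  have hj : j (omega K) = omega (InternalUltrapower U) := isOmega_iff.1 (isOmega_omega.map j)
  have hjn : ∀ n, n ∈ₘ omega K → j n ∈ₘ omega (InternalUltrapower U) := by
    intro n hn
    rw [← hj]
    refine (mk_mem_mk hU).2 (inU_of_forall hU fun k hk => ?_)
    rwa [ev_constSeq hk, ev_constSeq hk]
  let d : {f : K // IsOmegaSeq f} :=
    ⟨lam (omega K) fun n => n, isOmegaSeq_iff.2 (isFunOn_lam _ _)⟩
  have hd : InternalUltrapower.mk U d ∈ₘ omega (InternalUltrapower U) := by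
    rw [← hj]
    refine (mk_mem_mk hU).2 (inU_of_forall hU fun k hk => ?_)
    rw [ev_constSeq hk, ev_lam hk]
    exact hk
  have hjd : ∀ n, n ∈ₘ omega K → j n ∈ₘ InternalUltrapower.mk U d := fun n hn =>
    (mk_mem_mk hU).2 ((inU_mem hU hn).congr fun k hk => by rw [ev_constSeq hk, ev_lam hk])
  let N := e ⟨_, hd⟩
  -- If `ω` of the ultrapower were isomorphic to `ℕ`, the class of the identity would have just `N`
  -- predecessors, yet the infinitely many `j(n)` are among them.
  let F : ℕ → Fin N := fun i => ⟨e ⟨j (e'.symm i).1, hjn _ (e'.symm i).2⟩,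
    e.map_rel_iff.2 (hjd _ (e'.symm i).2)⟩
  refine not_injective_infinite_finite F fun a b hab => ?_
  have h1 := e.injective (Fin.mk.inj_iff.1 hab)
  exact e'.symm.injective (Subtype.ext (j.injective (Subtype.mk.inj h1)))

end Los

/-! ### Failure of the three conditions -/

section Absoluteness

variable {K M : Type u} [LSet.Structure K] [LSet.Structure M] [hK : ZFModel K] [hM : ZFModel M]

/-- `F` is an isomorphism onto a transitive class. -/
structure IsTransitiveEmbedding (F : K → M) : Prop where
  injective : Function.Injective F
  mem_iff : ∀ a b, a ∈ₘ b ↔ F a ∈ₘ F b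
  transitive : ∀ x a, x ∈ₘ F a → x ∈ Set.range F

namespace IsTransitiveEmbedding

variable {F : K → M}

theorem map_emptySet (hF : IsTransitiveEmbedding F) : F emptySet = emptySet := by
  refine ext_mem fun z => iff_of_false (fun hz => ?_) (not_mem_emptySet z)
  obtain ⟨c, rfl⟩ := hF.transitive z _ hz
  exact not_mem_emptySet c ((hF.mem_iff _ _).2 hz)

theorem map_succ (hF : IsTransitiveEmbedding F) (x : K) : F (succ x) = succ (F x) := by
  refine ext_mem fun z => ⟨fun hz => ?_, fun hz => ?_⟩
  · obtain ⟨c, rfl⟩ := hF.transitive z _ hz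
    rcases mem_succ.1 ((hF.mem_iff _ _).2 hz) with h | rfl
    · exact mem_succ.2 (Or.inl ((hF.mem_iff _ _).1 h))
    · exact self_mem_succ _
  · rcases mem_succ.1 hz with h | rfl
    · obtain ⟨c, rfl⟩ := hF.transitive z _ h
      exact (hF.mem_iff _ _).1 (mem_succ.2 (Or.inl ((hF.mem_iff _ _).2 h)))
    · exact (hF.mem_iff _ _).1 (self_mem_succ _)

theorem isInductive_map_iff (hF : IsTransitiveEmbedding F) {a : K} :
    IsInductive (F a) ↔ IsInductive a := by
  rw [isInductive_iff, isInductive_iff, ← hF.map_emptySet, ← hF.mem_iff]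
  refine and_congr_right fun _ => ⟨fun h x hx => ?_, fun h y hy => ?_⟩
  · rw [hF.mem_iff, hF.map_succ]
    exact h _ ((hF.mem_iff _ _).1 hx)
  · obtain ⟨c, rfl⟩ := hF.transitive y _ hy
    rw [← hF.map_succ, ← hF.mem_iff]
    exact h c ((hF.mem_iff _ _).2 hy)

/-- Being inductive is preserved in both directions. The preimage of `ω` therefore includes `omega
K`, while `F (omega K)` includes `omega M`. -/
theorem map_omega (hF : IsTransitiveEmbedding F) (h : omega M ∈ Set.range F) :
    F (omega K) = omega M := by
  obtain ⟨a, ha⟩ := h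
  have h1 : IsInductive a := hF.isInductive_map_iff.1 (ha ▸ isOmega_omega.1)
  have h2 : IsInductive (F (omega K)) := hF.isInductive_map_iff.2 isOmega_omega.1
  rw [← ha]
  congr 1
  refine ext_mem fun z => ⟨isOmega_omega.2 a h1 z, fun hz => ?_⟩
  rw [hF.mem_iff] at hz ⊢
  exact isOmega_omega.2 _ h2 _ (ha ▸ hz)

theorem omegaStandard_iff (hF : IsTransitiveEmbedding F) (h : omega M ∈ Set.range F) :
    OmegaStandard K ↔ OmegaStandard M := by
  have hω := hF.map_omega h
  let G : {n : K // n ∈ₘ omega K} → {n : M // n ∈ₘ omega M} := fun n =>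
    ⟨F n.1, hω ▸ (hF.mem_iff _ _).1 n.2⟩
  have hG : Function.Bijective G := by
    refine ⟨fun a b hab => Subtype.ext (hF.injective (Subtype.mk.inj hab)), fun ⟨y, hy⟩ => ?_⟩
    obtain ⟨c, rfl⟩ := hF.transitive y (omega K) (hω ▸ hy)
    exact ⟨⟨c, (hF.mem_iff _ _).2 (hω ▸ hy)⟩, rfl⟩
  let E : (fun a b : {n : K // n ∈ₘ omega K} => a.1 ∈ₘ b.1) ≃r
      (fun a b : {n : M // n ∈ₘ omega M} => a.1 ∈ₘ b.1) :=
    ⟨Equiv.ofBijective G hG, fun {a b} => (hF.mem_iff a.1 b.1).symm⟩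
  constructor
  · rintro ⟨w, hw, ⟨e⟩⟩
    rw [isOmega_iff] at hw
    subst hw
    exact ⟨_, isOmega_omega, ⟨E.symm.trans e⟩⟩
  · rintro ⟨w, hw, ⟨e⟩⟩
    rw [isOmega_iff] at hw
    subst hw
    exact ⟨_, isOmega_omega, ⟨E.trans e⟩⟩

end IsTransitiveEmbedding

theorem omegaStandard_iff_of_bijective {F : K → M} (hF : Function.Bijective F)
    (h : ∀ a b, a ∈ₘ b ↔ F a ∈ₘ F b) : OmegaStandard K ↔ OmegaStandard M :=
  IsTransitiveEmbedding.omegaStandard_iff ⟨hF.1, h, fun x _ _ => hF.2 x⟩ (hF.2 _)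

variable (i : K ↪ M)

/-- `V_κ` is transitive and contains `ω` because `ω ∈ κ`, so the isomorphism would transfer
`ω`-standardness from `K` to `M`. -/
theorem not_claimCondition1 (hstd : OmegaStandard K) (hnstd : ¬ OmegaStandard M) :
    ¬ ClaimCondition1 i := by
  rintro ⟨κ, v, ⟨hκ, ⟨w, hw, hwκ⟩, -⟩, hv, F, hF, hrange, hmem, -⟩
  rw [isOmega_iff] at hw
  subst hw
  obtain ⟨-, rfl⟩ := isV_iff.1 hv
  have hR : ∀ x, x ∈ Set.range F ↔ x ∈ₘ vLevel κ := fun x => by rw [hrange]; rfl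
  have hF' : IsTransitiveEmbedding F :=
    ⟨hF, hmem, fun x a hx => (hR x).2 (isTrans_vLevel hκ _ ((hR _).1 ⟨a, rfl⟩) x hx)⟩
  exact hnstd ((hF'.omegaStandard_iff ((hR _).2 (sub_vLevel_self hκ _ hwκ))).1 hstd)

theorem not_claimCondition2 (hstd : OmegaStandard K) (hnstd : ¬ OmegaStandard M) :
    ¬ ClaimCondition2 i := by
  rintro ⟨F, hF, hmem, -⟩
  exact hnstd ((omegaStandard_iff_of_bijective hF hmem).1 hstd)

theorem not_claimCondition3 (hstd : OmegaStandard K) (hnstd : ¬ OmegaStandard M) :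
    ¬ ClaimCondition3 i := by
  rintro ⟨F, hF, hmem, hrank, -⟩
  have hF' : IsTransitiveEmbedding F :=
    ⟨hF, hmem, fun x a hx => hrank x (F a) ⟨a, rfl⟩ (rankLE_of_mem hx)⟩
  -- The image of `omega M` is inductive in `K`, hence includes `omega K`; the latter has no larger
  -- rank and so lies in the initial segment.
  have hω : omega K ∈ Set.range F := hrank _ (F (omega M)) ⟨_, rfl⟩
    (rankLE_of_sub (isOmega_omega.2 _ (hF'.isInductive_map_iff.2 isOmega_omega.1)))
  exact hnstd ((hF'.omegaStandard_iff hω).2 hstd)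

end Absoluteness

/-! ### From conservativity to the refutation, with `K` an actual subset of `M` -/

theorem claimHypotheses_of_conservative {K M : Type u} [LSet.Structure K] [LSet.Structure M]
    (i : K ↪ M) (hK : K ⊨ ZF memSym) (hM : M ⊨ ZF memSym) (h : Conservative i) :
    ClaimHypotheses i := by
  have := zfModel_of_model hK
  exact ⟨hM, hK, fun D hD => modelsZFP_of_dfn (dfn_of_definable₁ (h D hD))⟩

theorem Dfn.map_equiv {K N : Type u} [LSet.Structure K] [LSet.Structure N] (e : K ≃[LSet] N)
    {P : K → Prop} (hP : Dfn K P) {Q : N → Prop} (h : ∀ k, Q (e k) ↔ P k) : Dfn N Q := by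
  obtain ⟨φ, hφ⟩ := hP.exists_formula
  refine ⟨⟨φ.relabel (Sum.map e id), fun x => ?_⟩⟩
  obtain ⟨k, rfl⟩ := e.toEquiv.surjective x
  refine Iff.trans ?_ ((hφ k).trans (h k).symm)
  rw [Formula.realize_relabel, ← StrongHomClass.realize_formula e φ]
  refine iff_of_eq (congrArg φ.Realize (funext fun a => ?_))
  rcases a with a | a <;> rfl

/-- Conservativity survives replacing `K` by an isomorphic copy with the same image in `M`. This
allows passage from an embedding to its range. -/
theorem conservative_congr {K N M : Type u} [LSet.Structure K] [LSet.Structure N]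
    [LSet.Structure M] (e : K ≃[LSet] N) {i : K ↪ M} {i' : N ↪ M} (h : ∀ k, i' (e k) = i k)
    (hi : Conservative i) : Conservative i' := fun D hD =>
  ((dfn_of_definable₁ (hi D hD)).map_equiv e
    fun k => by simp only [Set.mem_preimage, h]).definable₁

/-- The claim fails for every conservative extension of an `ω`-standard model to a model that is
not `ω`-standard. -/
theorem not_incorrectClaim {K M : Type u} [LSet.Structure K] [LSet.Structure M] (i : K ↪ M)
    (hK : K ⊨ ZF memSym) (hM : M ⊨ ZF memSym) (h : Conservative i) (hstd : OmegaStandard K)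
    (hnstd : ¬ OmegaStandard M) : ¬ IncorrectClaim.{u} := by
  intro hclaim
  -- The claim concerns subsets of `M`, so the structure of `K` is transported to the range of `i`.
  let e : K ≃ Set.range i := Equiv.ofInjective i i.injective
  let _ : LSet.Structure (Set.range i) := e.inducedStructure
  let E : K ≃[LSet] Set.range i := e.inducedStructureEquiv
  have hK' : Set.range i ⊨ ZF memSym := (StrongHomClass.theory_model E (T := ZF memSym))
  have := zfModel_of_model hK
  have := zfModel_of_model hM
  have := zfModel_of_model hK'
  have hstd' : OmegaStandard (Set.range i) := by
    refine (omegaStandard_iff_of_bijective (F := E) E.bijective fun a b => ?_).1 hstd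
    have := E.map_rel memSym ![a, b]
    refine this.symm.trans (iff_of_eq (congrArg _ (funext fun k => ?_)))
    fin_cases k <;> rfl
  have hcons : Conservative (Function.Embedding.subtype (· ∈ Set.range i)) :=
    conservative_congr E (fun _ => rfl) h
  rcases hclaim M (Set.range i) (claimHypotheses_of_conservative _ hK' hM hcons) with h | h | h
  · exact not_claimCondition1 _ hstd' hnstd h.1
  · exact not_claimCondition2 _ hstd' hnstd h.2.1
  · exact not_claimCondition3 _ hstd' hnstd h.2.2

end SetModel

theorem mainTheorem5 {K : Type u} [SetModel.LSet.Structure K]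
    (hZFC : K ⊨ SetModel.ZFC SetModel.memSym)
    (hstd : SetModel.OmegaStandard K)
    (U : K) (hU : SetModel.IsNonprincipalUltrafilter U) :
    (∃ j : K ↪ₑ[SetModel.LSet] SetModel.InternalUltrapower U,
      (∀ k : K, ∃ f : {f : K // SetModel.IsOmegaSeq f},
        SetModel.IsConstSeq f.1 k ∧ j k = SetModel.InternalUltrapower.mk U f) ∧
      ¬ SetModel.OmegaStandard (SetModel.InternalUltrapower U) ∧
      SetModel.Conservative j.toEmbedding.toEmbedding ∧
      SetModel.ClaimHypotheses j.toEmbedding.toEmbedding ∧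
      ¬ SetModel.ClaimCondition1 j.toEmbedding.toEmbedding ∧
      ¬ SetModel.ClaimCondition2 j.toEmbedding.toEmbedding ∧
      ¬ SetModel.ClaimCondition3 j.toEmbedding.toEmbedding) ∧
    ¬ SetModel.IncorrectClaim.{u} := by
  have hZF : K ⊨ SetModel.ZF SetModel.memSym := hZFC.mono Set.subset_union_left
  have := SetModel.zfcModel_of_model hZFC
  have hM := SetModel.zfModel_ultrapower hZF hU
  have := SetModel.zfModel_of_model hM
  have hnstd := SetModel.not_omegaStandard_ultrapower hstd hU
  have hcons := SetModel.conservative_ultrapowerEmbedding hU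
  exact ⟨⟨SetModel.ultrapowerEmbedding hU,
    fun k => ⟨SetModel.constSeq k, SetModel.isConstSeq_constSeq k, rfl⟩, hnstd, hcons,
    SetModel.claimHypotheses_of_conservative _ hZF hM hcons,
    SetModel.not_claimCondition1 _ hstd hnstd, SetModel.not_claimCondition2 _ hstd hnstd,
    SetModel.not_claimCondition3 _ hstd hnstd⟩,
    SetModel.not_incorrectClaim _ hZF hM hcons hstd hnstd⟩
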